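/- **Setting.** There are $K$ users, $N_f\ge 1$ pulses per symbol, $N_c$ pulse positions per frame, processing gain $N=N_fN_c$, and $L$ channel paths. User $k$ has path gains $\alpha_k=(\alpha_{k,1},\dots,\alpha_{k,L})^T\in\mathbb C^L$. A partial-Rake receiver with $L_P$ fingers ($0<L_P\le L$) and maximal ratio combining uses the weights $\beta_k=(\alpha_{k,1},\dots,\alpha_{k,L_P},0,\dots,0)^T$. For $a\in\mathbb C^L$ let $M(a)$ be the $L\times(L-1)$ matrix with entries $M(a)_{i,m}=a_{L-m+i}$ for $i\le m$ and $0$ for $i>m$. Put $A_k=M(\alpha_k)$, $B_k=M(\beta_k)$, and $\Phi=\mathrm{diag}(\varphi_1,\dots,\varphi_{L-1})$ with $\varphi_l=\sqrt{\min\{L-l,N_c\}/N_c}$. Define $$h^{SP}_k=\beta_k^H\alpha_k,\qquad h^{SI}_k=\frac1N\,\frac{\|\Phi(B_k^H\alpha_k+A_k^H\beta_k)\|^2}{\beta_k^H\alpha_k},\qquad h^{MAI}_{kj}=\frac1N\,\frac{\|B_k^H\alpha_j\|^2+\|A_j^H\beta_k\|^2+|\beta_k^H\alpha_j|^2}{\beta_k^H\alpha_k},$$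 $$\zeta_k^{-1}=\sum_{j\ne k}\frac{h^{MAI}_{kj}}{h^{SP}_j},\qquad \gamma_k=\frac{h^{SP}_k}{h^{SI}_k}.$$ **Assumptions.** Let $\Psi>0$ and $\sigma_k^2>0$ for every $k$. The gains $\alpha_{k,l}$ ($1\le k\le K$, $1\le l\le L$) are independent circularly symmetric complex Gaussian variables with mean $0$ and variance $\sigma_k^2\,\Psi^{-(l-1)/(L-1)}$ (for $L=1$ the variance is $\sigma_k^2$). Consider a sequence of such systems on one probability space, with $K$, $N_f$, $\Psi$ and the $\sigma_k^2$ fixed, in which $L$ increases strictly, $L_P/L\to\rho$ and $N_c/L\to\beta$, where $0<\rho\le1$ and $0<\beta<\infty$ (in particular the ratios may be constant, $L_P/L=\rho$ and $N_c/L=\beta$). Nothing is assumed on the joint distribution of the gains of different systems of the sequence. **Conclusion.** For every user $k$, almost surely $$N\,\zeta_k^{-1}\to(K-1)\,\mu(\Psi,\rho)\qquad\text{and}\qquad N\,\gamma_k^{-1}\to\nu(\Psi,\rho,\beta),$$ that is, $\zeta_k^{-1}$ behaves as $\frac{K-1}{N}\mu(\Psi,\rho)$ and $\gamma_k^{-1}$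 as $\frac1N\nu(\Psi,\rho,\beta)$. Here, for $\Psi\neq1$, $$\mu(\Psi,\rho)=\frac{(\Psi-1)\Psi^{\rho-1}}{\Psi^\rho-1},$$ and $\nu(\Psi,\rho,\beta)$ equals $$\frac{\Psi(\Psi^\beta-1)(4\Psi^{2\rho}+3\Psi^\beta-1)-2\Psi^{\rho+\beta}(\Psi^\rho+3\Psi-1)\beta\log\Psi}{2(\Psi^\rho-1)^2\beta\Psi^{1+\beta}\log\Psi}\quad\text{if }0\le\beta\le\min(\rho,1-\rho);$$ $$\frac{\Psi(4\Psi^\beta-1)(\Psi^{2\rho}-1)-2\Psi^{\rho+\beta}(3\Psi\rho-\beta+\Psi^\rho\beta)\log\Psi}{2(\Psi^\rho-1)^2\beta\Psi^{1+\beta}\log\Psi}\quad\text{if }\rho\le\beta\le1-\rho\ (\rho\le\tfrac12);$$ $$\frac{-4\Psi^{2+2\rho}-4\Psi^{2+\beta}+\Psi^{2(\rho+\beta)}+4\Psi^{2+2\rho+\beta}+3\Psi^{2+2\beta}-2\Psi^{1+\rho+\beta}(\rho+3\Psi\beta+\Psi^\rho\beta-1)\log\Psi}{2(\Psi^\rho-1)^2\beta\Psi^{2+\beta}\log\Psi}\quad\text{if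 }1-\rho\le\beta\le\rho\ (\rho\ge\tfrac12);$$ $$\frac{-\Psi^{2+2\rho}-4\Psi^{2+\beta}+\Psi^{2(\rho+\beta)}+4\Psi^{2+2\rho+\beta}-2\Psi^{1+\rho+\beta}(\rho+3\Psi\rho+\Psi^\rho\beta-1)\log\Psi}{2(\Psi^\rho-1)^2\beta\Psi^{2+\beta}\log\Psi}\quad\text{if }\max(\rho,1-\rho)\le\beta\le1;$$ $$\frac{2\Psi(\Psi^{2\rho}-1)-(\Psi^\rho+\rho+3\Psi\rho-1)\Psi^\rho\log\Psi}{(\Psi^\rho-1)^2\beta\Psi\log\Psi}\quad\text{if }\beta\ge1.$$ For $\Psi=1$ (flat profile) $\mu$ and $\nu$ stand for the limits of these expressions as $\Psi\to1$. -/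

import Mathlib

open MeasureTheory ProbabilityTheory Filter Topology Matrix

noncomputable section

namespace PRake

/-- The circularly symmetric complex Gaussian law `CN(0, v)`: real and imaginary part are
independent real Gaussians with mean `0` and variance `v / 2`. -/
def circGaussian (v : ℝ) : Measure ℂ :=
  ((gaussianReal 0 (v / 2).toNNReal).prod (gaussianReal 0 (v / 2).toNNReal)).map
    (fun p : ℝ × ℝ => (⟨p.1, p.2⟩ : ℂ))

/-- Exponentially decaying power delay profile: the variance of path `l` (counted from `0`) of a
channel with `L` paths, whose first path has variance `s` and whose ratio of the first to
the last variance is `Ψ`. -/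
def pathVar (s Ψ : ℝ) (L : ℕ) (l : Fin L) : ℝ :=
  s * Ψ ^ (-(((l : ℕ) : ℝ) / ((L : ℝ) - 1)))

/-- The processing matrix of a partial-Rake with `LP` fingers (maximal ratio combining). -/
def procMatrix (L LP : ℕ) : Matrix (Fin L) (Fin L) ℂ :=
  Matrix.diagonal (fun l => if (l : ℕ) + 1 ≤ LP then 1 else 0)

/-- The vector of combining weights belonging to the vector `a` of path gains. -/
def rake (L LP : ℕ) (a : Fin L → ℂ) : Fin L → ℂ := procMatrix L LP *ᵥ a

/-- The `L × (L - 1)` matrix whose columns are, from left to right, `(a_L, 0, …, 0)`,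
`(a_{L-1}, a_L, 0, …, 0)`, …, `(a_2, …, a_L, 0)`. -/
def shiftMatrix {L : ℕ} (a : Fin L → ℂ) : Matrix (Fin L) (Fin (L - 1)) ℂ :=
  fun i j => if h : (i : ℕ) ≤ (j : ℕ) then
    a ⟨L - 1 - (j : ℕ) + (i : ℕ), by have := j.isLt; omega⟩ else 0

/-- `Φ = diag(φ_1, …, φ_{L-1})` with `φ_l = √(min(L - l, Nc) / Nc)`. -/
def phiMatrix (L Nc : ℕ) : Matrix (Fin (L - 1)) (Fin (L - 1)) ℂ :=
  Matrix.diagonal (fun j =>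
    ((Real.sqrt (((min (L - ((j : ℕ) + 1)) Nc : ℕ) : ℝ) / (Nc : ℝ)) : ℝ) : ℂ))

/-- Squared Euclidean norm of a complex vector. -/
def sqNorm {m : ℕ} (v : Fin m → ℂ) : ℝ := ‖(WithLp.toLp 2 v : EuclideanSpace ℂ (Fin m))‖ ^ 2

/-- The signal gain `bᴴ a`, for combining weights `b` and path gains `a`. For the weights
of a partial-Rake this number is real and nonnegative. -/
def hSP {L : ℕ} (b a : Fin L → ℂ) : ℝ := (star b ⬝ᵥ a).re

/-- The self-interference gain of a user with path gains `a` and combining weights `b`, for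
`Nf` pulses per symbol and `Nc` pulse positions per frame (processing gain `Nf * Nc`). -/
def hSI {L : ℕ} (Nf Nc : ℕ) (b a : Fin L → ℂ) : ℝ :=
  1 / ((Nf : ℝ) * Nc) *
    (sqNorm (phiMatrix L Nc *ᵥ ((shiftMatrix b)ᴴ *ᵥ a + (shiftMatrix a)ᴴ *ᵥ b)) / hSP b a)

/-- The multiple access interference gain at the receiver of a user with path gains `a` and
combining weights `b`, caused by a user with path gains `a'`. -/
def hMAI {L : ℕ} (Nf Nc : ℕ) (b a a' : Fin L → ℂ) : ℝ :=
  1 / ((Nf : ℝ) * Nc) *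
    ((sqNorm ((shiftMatrix b)ᴴ *ᵥ a') + sqNorm ((shiftMatrix a')ᴴ *ᵥ b)
      + ‖star b ⬝ᵥ a'‖ ^ 2) / hSP b a)

/-- The inverse MAI ratio of user `k`: the sum over the other users `j` of `hMAI_{kj} / hSP_j`. -/
def maiRatioInv {K L : ℕ} (Nf Nc LP : ℕ) (α : Fin K → Fin L → ℂ) (k : Fin K) : ℝ :=
  ∑ j ∈ Finset.univ.erase k,
    hMAI Nf Nc (rake L LP (α k)) (α k) (α j) / hSP (rake L LP (α j)) (α j)

/-- The SI ratio `hSP_k / hSI_k` of user `k`. -/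
def siRatio {K L : ℕ} (Nf Nc LP : ℕ) (α : Fin K → Fin L → ℂ) (k : Fin K) : ℝ :=
  hSP (rake L LP (α k)) (α k) / hSI Nf Nc (rake L LP (α k)) (α k)

/-- The closed form of `μ`, for `Ψ ≠ 1`. -/
def muForm (Ψ ρ : ℝ) : ℝ := ((Ψ - 1) * Ψ ^ (ρ - 1)) / (Ψ ^ ρ - 1)

/-- `0 ≤ β ≤ min(ρ, 1 - ρ)` -/
def nuForm₁ (Ψ ρ β : ℝ) : ℝ :=
  (Ψ * (Ψ ^ β - 1) * (4 * Ψ ^ (2 * ρ) + 3 * Ψ ^ β - 1)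
      - 2 * Ψ ^ (ρ + β) * (Ψ ^ ρ + 3 * Ψ - 1) * β * Real.log Ψ) /
    (2 * (Ψ ^ ρ - 1) ^ 2 * β * Ψ ^ (1 + β) * Real.log Ψ)

/-- `ρ ≤ β ≤ 1 - ρ` -/
def nuForm₂ (Ψ ρ β : ℝ) : ℝ :=
  (Ψ * (4 * Ψ ^ β - 1) * (Ψ ^ (2 * ρ) - 1)
      - 2 * Ψ ^ (ρ + β) * (3 * Ψ * ρ - β + Ψ ^ ρ * β) * Real.log Ψ) /
    (2 * (Ψ ^ ρ - 1) ^ 2 * β * Ψ ^ (1 + β) * Real.log Ψ)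

/-- `1 - ρ ≤ β ≤ ρ` -/
def nuForm₃ (Ψ ρ β : ℝ) : ℝ :=
  (-4 * Ψ ^ (2 + 2 * ρ) - 4 * Ψ ^ (2 + β) + Ψ ^ (2 * (ρ + β)) + 4 * Ψ ^ (2 + 2 * ρ + β)
      + 3 * Ψ ^ (2 + 2 * β)
      - 2 * Ψ ^ (1 + ρ + β) * (ρ + 3 * Ψ * β + Ψ ^ ρ * β - 1) * Real.log Ψ) /
    (2 * (Ψ ^ ρ - 1) ^ 2 * β * Ψ ^ (2 + β) * Real.log Ψ)

/-- `max(ρ, 1 - ρ) ≤ β ≤ 1` -/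
def nuForm₄ (Ψ ρ β : ℝ) : ℝ :=
  (-Ψ ^ (2 + 2 * ρ) - 4 * Ψ ^ (2 + β) + Ψ ^ (2 * (ρ + β)) + 4 * Ψ ^ (2 + 2 * ρ + β)
      - 2 * Ψ ^ (1 + ρ + β) * (ρ + 3 * Ψ * ρ + Ψ ^ ρ * β - 1) * Real.log Ψ) /
    (2 * (Ψ ^ ρ - 1) ^ 2 * β * Ψ ^ (2 + β) * Real.log Ψ)

/-- `1 ≤ β` -/
def nuForm₅ (Ψ ρ β : ℝ) : ℝ :=
  (2 * Ψ * (Ψ ^ (2 * ρ) - 1) - (Ψ ^ ρ + ρ + 3 * Ψ * ρ - 1) * Ψ ^ ρ * Real.log Ψ) /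
    ((Ψ ^ ρ - 1) ^ 2 * β * Ψ * Real.log Ψ)

/-- The closed form of `ν`, for `Ψ ≠ 1`. (The ranges of the five cases overlap in
boundary points only, where the expressions agree.) -/
def nuForm (Ψ ρ β : ℝ) : ℝ :=
  if β ≤ min ρ (1 - ρ) then nuForm₁ Ψ ρ β
  else if ρ ≤ β ∧ β ≤ 1 - ρ then nuForm₂ Ψ ρ β
  else if 1 - ρ ≤ β ∧ β ≤ ρ then nuForm₃ Ψ ρ β
  else if max ρ (1 - ρ) ≤ β ∧ β ≤ 1 then nuForm₄ Ψ ρ β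
  else nuForm₅ Ψ ρ β

/-- The function `μ`; at `Ψ = 1` (flat profile) the closed form reads `0 / 0` and
stands for its limit as `Ψ → 1`. -/
def mu (Ψ ρ : ℝ) : ℝ :=
  if Ψ = 1 then limUnder (𝓝[≠] (1 : ℝ)) (fun ψ => muForm ψ ρ) else muForm Ψ ρ

/-- The function `ν`, with the same convention at `Ψ = 1`. -/
def nu (Ψ ρ β : ℝ) : ℝ :=
  if Ψ = 1 then limUnder (𝓝[≠] (1 : ℝ)) (fun ψ => nuForm ψ ρ β) else nuForm Ψ ρ β

end PRake

end

noncomputable section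

namespace PRake

/-! The factor `N` cancels in both ratios: `N ζ⁻¹` is a sum of quotients (energy of the interference
of user `j`) / (power of `k` × power of `j`), and `N γ⁻¹` is (energy of the self-interference) /
(power of `k`)². Powers are of order `L` and energies of order `L²`, so it suffices to find the
almost sure limits of powers over `L` and of energies over `L²`.

Concentration. An energy is a quadrilinear form in the gains whose indices satisfy one linear
relation, because the two pairs being multiplied have the same lag. Its diagonal part is close to,
or equal to, an explicit expression in the powers or variances. The off-diagonal part is summed in
an order of the indices that makes each sum a martingale, and for martingales the squared `L⁴` norm
is additive up to a constant (`L4Bound.add_indep_mul`, `L4Bound.sum_martingale`). Three free indices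
give a squared `L⁴` norm of order `L³`. After division by `L²` the fourth moment is `O(L⁻²)`, which
is summable along strictly increasing `L`; almost sure convergence follows whatever the joint law of
the different systems (`ae_tendsto_zero_of_l4Bound`).

Limits of the means. With `t = log Ψ` the sums of variances are Riemann sums of `exp (-t x)`.
Because the profile is geometric, the expected self-interference is a combination of one function
`pairIntegral` at `ρ`, `1` and `1 - ρ` (`expected_siEnergy`). That function has one closed form for
`a ≤ β` and another for `β ≤ a`, and this produces the five cases of `ν`. The integrals are
continuous in `t`, also at `t = 0`, which settles the flat profile. -/

/-- `f` is measurable and `‖f‖_{L⁴}² ≤ B`. -/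
structure L4Bound {Ω : Type*} [MeasurableSpace Ω] (P : Measure Ω) (f : Ω → ℂ) (B : ℝ) : Prop where
  meas : Measurable f
  nonneg : 0 ≤ B
  int : Integrable (fun ω => ‖f ω‖ ^ 4) P
  le : ∫ ω, ‖f ω‖ ^ 4 ∂P ≤ B ^ 2

/-! ### Fourth-moment calculus and a martingale inequality -/

section L4

variable {Ω : Type*} {m mΩ : MeasurableSpace Ω} {P : Measure Ω}

/-- Cauchy–Schwarz, from the discriminant of the nonnegative quadratic `t ↦ ∫ (f - t g)²`. -/
theorem integral_mul_le_of_sq_le {f g : Ω → ℝ} {a b : ℝ} (ha : 0 ≤ a) (hb : 0 ≤ b)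
    (hf : Integrable (fun ω => f ω ^ 2) P) (hg : Integrable (fun ω => g ω ^ 2) P)
    (hfg : Integrable (fun ω => f ω * g ω) P)
    (hfa : ∫ ω, f ω ^ 2 ∂P ≤ a ^ 2) (hgb : ∫ ω, g ω ^ 2 ∂P ≤ b ^ 2) :
    ∫ ω, f ω * g ω ∂P ≤ a * b := by
  have key : ∀ t : ℝ, 0 ≤ (∫ ω, g ω ^ 2 ∂P) * (t * t) + (-2 * ∫ ω, f ω * g ω ∂P) * t
      + ∫ ω, f ω ^ 2 ∂P := by
    intro t
    have h : ∫ ω, (f ω - t * g ω) ^ 2 ∂P = (∫ ω, g ω ^ 2 ∂P) * (t * t)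
        + (-2 * ∫ ω, f ω * g ω ∂P) * t + ∫ ω, f ω ^ 2 ∂P := by
      have : (fun ω => (f ω - t * g ω) ^ 2)
          = fun ω => (t * t) * g ω ^ 2 + (-2 * t) * (f ω * g ω) + f ω ^ 2 := by
        ext ω; ring
      have hi : Integrable (fun ω => t * t * g ω ^ 2 + -2 * t * (f ω * g ω)) P :=
        (hg.const_mul (t * t)).add (hfg.const_mul (-2 * t))
      rw [this, integral_add hi hf,
        integral_add (hg.const_mul (t * t)) (hfg.const_mul (-2 * t)), integral_const_mul,
        integral_const_mul]
      ring
    rw [← h]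
    exact integral_nonneg fun ω => sq_nonneg _
  have hd := discrim_le_zero key
  rw [discrim] at hd
  have h1 : (∫ ω, f ω * g ω ∂P) ^ 2 ≤ (a * b) ^ 2 := by
    have hg0 : 0 ≤ ∫ ω, g ω ^ 2 ∂P := integral_nonneg fun ω => sq_nonneg _
    have hf0 : 0 ≤ ∫ ω, f ω ^ 2 ∂P := integral_nonneg fun ω => sq_nonneg _
    have := mul_le_mul hfa hgb hg0 (sq_nonneg a)
    nlinarith
  exact (le_abs_self _).trans (abs_le_of_sq_le_sq h1 (mul_nonneg ha hb))

theorem indepFun_of_indep {β γ : Type*} [MeasurableSpace β] [mγ : MeasurableSpace γ]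
    {x : Ω → β} {g : Ω → γ}
    (h : Indep (MeasurableSpace.comap x inferInstance) m P) (hg : Measurable[m] g) :
    IndepFun x g P := by
  rw [IndepFun_iff_Indep]
  exact indep_of_indep_of_le_right h hg.comap_le

namespace L4Bound

theorem mono {f : Ω → ℂ} {B B' : ℝ} (h : L4Bound P f B) (hB : B ≤ B') : L4Bound P f B' :=
  ⟨h.meas, h.nonneg.trans hB, h.int, h.le.trans (pow_le_pow_left₀ h.nonneg hB 2)⟩

theorem const [IsProbabilityMeasure P] (c : ℂ) : L4Bound P (fun _ => c) (‖c‖ ^ 2) :=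
  ⟨measurable_const, by positivity, integrable_const _, by simp; apply le_of_eq; ring⟩

theorem of_norm_le {f g : Ω → ℂ} {B : ℝ} (h : L4Bound P f B) (hg : Measurable g)
    (hgf : ∀ ω, ‖g ω‖ ≤ ‖f ω‖) : L4Bound P g B := by
  have h4 : ∀ ω, ‖g ω‖ ^ 4 ≤ ‖f ω‖ ^ 4 := fun ω =>
    pow_le_pow_left₀ (norm_nonneg _) (hgf ω) 4
  have hi : Integrable (fun ω => ‖g ω‖ ^ 4) P := h.int.mono' (by fun_prop)
    (ae_of_all _ fun ω => by rw [Real.norm_of_nonneg (by positivity)]; exact h4 ω)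
  exact ⟨hg, h.nonneg, hi, (integral_mono hi h.int h4).trans h.le⟩

theorem conj {f : Ω → ℂ} {B : ℝ} (h : L4Bound P f B) :
    L4Bound P (fun ω => starRingEnd ℂ (f ω)) B :=
  h.of_norm_le (Complex.continuous_conj.measurable.comp h.meas) (by simp)

theorem const_mul {f : Ω → ℂ} {B : ℝ} (h : L4Bound P f B) (c : ℂ) :
    L4Bound P (fun ω => c * f ω) (‖c‖ ^ 2 * B) := by
  have e : (fun ω => ‖c * f ω‖ ^ 4) = fun ω => ‖c‖ ^ 4 * ‖f ω‖ ^ 4 := by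
    ext ω; rw [norm_mul, mul_pow]
  refine ⟨h.meas.const_mul c, mul_nonneg (by positivity) h.nonneg, ?_, ?_⟩
  · rw [e]; exact h.int.const_mul _
  · rw [e, integral_const_mul]
    calc _ ≤ ‖c‖ ^ 4 * B ^ 2 := mul_le_mul_of_nonneg_left h.le (by positivity)
      _ = _ := by ring

/-- Triangle inequality in `L⁴`, without any cancellation: the cost is the square of the number of
terms, against a linear cost for martingales. -/
theorem sum {κ : Type*} (s : Finset κ) {f : κ → Ω → ℂ} {B : ℝ} (hB : 0 ≤ B)
    (h : ∀ i ∈ s, L4Bound P (f i) B) :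
    L4Bound P (fun ω => ∑ i ∈ s, f i ω) ((s.card : ℝ) ^ 2 * B) := by
  have hm : Measurable (fun ω => ∑ i ∈ s, f i ω) :=
    Finset.measurable_sum s fun i hi => (h i hi).meas
  have hp : ∀ ω, ‖∑ i ∈ s, f i ω‖ ^ 4 ≤ (s.card : ℝ) ^ 3 * ∑ i ∈ s, ‖f i ω‖ ^ 4 := fun ω =>
    (pow_le_pow_left₀ (norm_nonneg _) (norm_sum_le _ _) 4).trans
      (pow_sum_le_card_mul_sum_pow (fun i _ => norm_nonneg (f i ω)) 3)
  have hI : Integrable (fun ω => (s.card : ℝ) ^ 3 * ∑ i ∈ s, ‖f i ω‖ ^ 4) P :=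
    (integrable_finsetSum s fun i hi => (h i hi).int).const_mul _
  have hJ : Integrable (fun ω => ‖∑ i ∈ s, f i ω‖ ^ 4) P :=
    hI.mono' (hm.norm.pow_const 4 |>.aestronglyMeasurable) (ae_of_all _ fun ω => by
      rw [Real.norm_of_nonneg (by positivity)]; exact hp ω)
  refine ⟨hm, by positivity, hJ, (integral_mono hJ hI hp).trans ?_⟩
  rw [integral_const_mul, integral_finsetSum s fun i hi => (h i hi).int]
  calc (s.card : ℝ) ^ 3 * ∑ i ∈ s, ∫ ω, ‖f i ω‖ ^ 4 ∂P
      ≤ (s.card : ℝ) ^ 3 * ∑ i ∈ s, B ^ 2 :=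
        mul_le_mul_of_nonneg_left (Finset.sum_le_sum fun i hi => (h i hi).le) (by positivity)
    _ = ((s.card : ℝ) ^ 2 * B) ^ 2 := by rw [Finset.sum_const, nsmul_eq_mul]; ring

theorem add {f g : Ω → ℂ} {B B' : ℝ} (hf : L4Bound P f B) (hg : L4Bound P g B') :
    L4Bound P (fun ω => f ω + g ω) (4 * (B + B')) := by
  have hB : 0 ≤ B + B' := add_nonneg hf.nonneg hg.nonneg
  have := sum (P := P) (Finset.univ : Finset (Fin 2)) (f := ![f, g]) hB
    (by
      intro i _
      fin_cases i
      · exact hf.mono (by linarith [hg.nonneg])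
      · exact hg.mono (by linarith [hf.nonneg]))
  simp [Fin.sum_univ_two] at this
  exact this.mono (by linarith)

theorem indep_mul {x Z : Ω → ℂ} {a B : ℝ}
    (hx : L4Bound P x a) (hZ : L4Bound P Z B)
    (hind : Indep (MeasurableSpace.comap x inferInstance) m P) (hZm : Measurable[m] Z) :
    L4Bound P (fun ω => x ω * Z ω) (a * B) := by
  have hi : IndepFun (fun ω => ‖x ω‖ ^ 4) (fun ω => ‖Z ω‖ ^ 4) P :=
    (indepFun_of_indep hind hZm).comp (φ := fun z : ℂ => ‖z‖ ^ 4) (ψ := fun z : ℂ => ‖z‖ ^ 4)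
      (by fun_prop) (by fun_prop)
  have e : (fun ω => ‖x ω * Z ω‖ ^ 4) = fun ω => ‖x ω‖ ^ 4 * ‖Z ω‖ ^ 4 := by
    ext ω; rw [norm_mul, mul_pow]
  refine ⟨hx.meas.mul hZ.meas, mul_nonneg hx.nonneg hZ.nonneg, ?_, ?_⟩
  · rw [e]; exact hi.integrable_mul hx.int hZ.int
  · rw [e, hi.integral_fun_mul_eq_mul_integral hx.int.1 hZ.int.1, mul_pow]
    exact mul_le_mul hx.le hZ.le (integral_nonneg fun _ => by positivity) (by positivity)

/-- One martingale step. In the expansion of `‖M + x Z‖ ^ 4` the term linear in `x` integrates to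
zero, since `x` is centred and independent of `m`; the rest is controlled by Cauchy–Schwarz and
independence. The coefficient of `B` stays `1`, so the step can be iterated. -/
theorem add_indep_mul [IsProbabilityMeasure P] {M x Z : Ω → ℂ} {a B B' : ℝ}
    (hm : m ≤ mΩ) (hM : L4Bound P M B) (hx : L4Bound P x a) (hZ : L4Bound P Z B')
    (hind : Indep (MeasurableSpace.comap x inferInstance) m P) (hx0 : ∫ ω, x ω ∂P = 0)
    (hMm : Measurable[m] M) (hZm : Measurable[m] Z) :
    L4Bound P (fun ω => M ω + x ω * Z ω) (B + 4 * a * B') := by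
  have hxZ := indep_mul hx hZ hind hZm
  have hMZ2 : Integrable (fun ω => ‖M ω‖ ^ 2 * ‖Z ω‖ ^ 2) P := by
    refine (hM.int.add hZ.int).mono' ?_ (ae_of_all _ fun ω => ?_)
    · have := hM.meas; have := hZ.meas; fun_prop
    · rw [Real.norm_of_nonneg (by positivity)]
      simp only [Pi.add_apply]
      nlinarith [sq_nonneg (‖M ω‖ ^ 2 - ‖Z ω‖ ^ 2), sq_nonneg (‖M ω‖ ^ 2), sq_nonneg (‖Z ω‖ ^ 2)]
  have hx2 : Integrable (fun ω => ‖x ω‖ ^ 2) P := by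
    refine (hx.int.add (integrable_const (1 : ℝ))).mono' ?_ (ae_of_all _ fun ω => ?_)
    · have := hx.meas; fun_prop
    · rw [Real.norm_of_nonneg (by positivity)]
      simp only [Pi.add_apply]
      nlinarith [sq_nonneg (‖x ω‖ ^ 2 - 1), sq_nonneg (‖x ω‖ ^ 2)]
  have hxi : Integrable x P := by
    refine (hx2.add (integrable_const (1 : ℝ))).mono' hx.meas.aestronglyMeasurable
      (ae_of_all _ fun ω => ?_)
    simp only [Pi.add_apply]
    nlinarith [sq_nonneg (‖x ω‖ - 1), norm_nonneg (x ω)]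
  -- the mixed moments
  set W : Ω → ℂ := fun ω => (‖M ω‖ ^ 2 : ℝ) * (starRingEnd ℂ (M ω) * Z ω) with hW
  have hWm : Measurable[m] W := by
    have h1 : Measurable[m] fun ω => ((‖M ω‖ ^ 2 : ℝ) : ℂ) :=
      (by fun_prop : Measurable fun z : ℂ => ((‖z‖ ^ 2 : ℝ) : ℂ)).comp hMm
    exact h1.mul ((Complex.continuous_conj.measurable.comp hMm).mul hZm)
  have hWi : Integrable W P := by
    refine (hM.int.add hZ.int).mono' (hWm.mono hm le_rfl).aestronglyMeasurable
      (ae_of_all _ fun ω => ?_)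
    simp only [hW, norm_mul, Pi.add_apply, RCLike.norm_conj, Complex.norm_real, norm_pow, norm_norm]
    have h1 := sq_nonneg (‖M ω‖ ^ 2 - ‖M ω‖ * ‖Z ω‖)
    have h2 := sq_nonneg (‖M ω‖ ^ 2 - ‖Z ω‖ ^ 2)
    have h3 : 0 ≤ ‖Z ω‖ ^ 4 := by positivity
    nlinarith
  have hi1 : IndepFun x W P := indepFun_of_indep hind hWm
  have hxWi : Integrable (fun ω => x ω * W ω) P := hi1.integrable_mul hxi hWi
  have hxW : ∫ ω, (x ω * W ω).re ∂P = 0 := by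
    have h := integral_re hxWi
    rw [hi1.integral_fun_mul_eq_mul_integral hxi.1 hWi.1, hx0, zero_mul] at h
    simpa using h
  have hi2 : IndepFun (fun ω => ‖x ω‖ ^ 2) (fun ω => ‖M ω‖ ^ 2 * ‖Z ω‖ ^ 2) P := by
    have h2 : Measurable[m] (fun ω => ‖M ω‖ ^ 2 * ‖Z ω‖ ^ 2) :=
      ((by fun_prop : Measurable fun z : ℂ => ‖z‖ ^ 2).comp hMm).mul
        ((by fun_prop : Measurable fun z : ℂ => ‖z‖ ^ 2).comp hZm)
    exact (indepFun_of_indep hind h2).comp (φ := fun z : ℂ => ‖z‖ ^ 2) (ψ := id)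
      (by fun_prop) measurable_id
  have hi2i : Integrable (fun ω => ‖x ω‖ ^ 2 * (‖M ω‖ ^ 2 * ‖Z ω‖ ^ 2)) P :=
    hi2.integrable_mul hx2 hMZ2
  have e4 : ∀ f : Ω → ℂ, (fun ω => (‖f ω‖ ^ 2) ^ 2) = fun ω => ‖f ω‖ ^ 4 := fun f => by
    ext ω; ring
  have hx2le : ∫ ω, ‖x ω‖ ^ 2 ∂P ≤ a := by
    have := integral_mul_le_of_sq_le (P := P) (f := fun ω => ‖x ω‖ ^ 2) (g := fun _ => 1)
      hx.nonneg zero_le_one (by rw [e4]; exact hx.int) (by simp) (by simpa using hx2)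
      (by rw [e4]; exact hx.le) (by simp)
    simpa using this
  have hMZle : ∫ ω, ‖M ω‖ ^ 2 * ‖Z ω‖ ^ 2 ∂P ≤ B * B' :=
    integral_mul_le_of_sq_le hM.nonneg hZ.nonneg (by rw [e4]; exact hM.int)
      (by rw [e4]; exact hZ.int) hMZ2 (by rw [e4]; exact hM.le) (by rw [e4]; exact hZ.le)
  have h3 : ∫ ω, ‖x ω‖ ^ 2 * (‖M ω‖ ^ 2 * ‖Z ω‖ ^ 2) ∂P ≤ a * (B * B') := by
    rw [hi2.integral_fun_mul_eq_mul_integral hx2.1 hMZ2.1]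
    exact mul_le_mul hx2le hMZle (integral_nonneg fun _ => by positivity) hx.nonneg
  -- Expand `(‖p‖² + 2r + ‖y‖²)²` and use `r² ≤ ‖p‖²‖y‖²` and `2‖p‖‖y‖³ ≤ ‖p‖²‖y‖² + ‖y‖⁴`: the
  -- coefficients are `2 + 4 + 2 = 8` and `1 + 2 = 3`.
  have hpt : ∀ ω, ‖M ω + x ω * Z ω‖ ^ 4 ≤ ‖M ω‖ ^ 4 + 4 * (x ω * W ω).re
      + 8 * (‖x ω‖ ^ 2 * (‖M ω‖ ^ 2 * ‖Z ω‖ ^ 2)) + 3 * ‖x ω * Z ω‖ ^ 4 := by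
    intro ω
    set p := M ω
    set y := x ω * Z ω with hy
    have hW' : (x ω * W ω).re = ‖p‖ ^ 2 * (starRingEnd ℂ p * y).re := by
      have : x ω * W ω = ((‖p‖ ^ 2 : ℝ) : ℂ) * (starRingEnd ℂ p * y) := by
        simp only [hW, hy]; ring
      rw [this, Complex.re_ofReal_mul]
    have hxy : ‖x ω‖ ^ 2 * (‖p‖ ^ 2 * ‖Z ω‖ ^ 2) = ‖p‖ ^ 2 * ‖y‖ ^ 2 := by
      rw [hy, norm_mul]; ring
    rw [hW', hxy]
    set r := (starRingEnd ℂ p * y).re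
    have hr : |r| ≤ ‖p‖ * ‖y‖ := by
      have := Complex.abs_re_le_norm (starRingEnd ℂ p * y)
      rwa [norm_mul, RCLike.norm_conj] at this
    have hs : ‖p + y‖ ^ 2 = ‖p‖ ^ 2 + 2 * r + ‖y‖ ^ 2 := by
      simp only [← Complex.normSq_eq_norm_sq, r, Complex.normSq_apply, Complex.mul_re,
        Complex.add_re, Complex.add_im, Complex.conj_re, Complex.conj_im]
      ring
    have h4 : ‖p + y‖ ^ 4 = (‖p‖ ^ 2 + 2 * r + ‖y‖ ^ 2) ^ 2 := by rw [← hs]; ring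
    rw [h4]
    have hr2 : r ^ 2 ≤ (‖p‖ * ‖y‖) ^ 2 :=
      sq_le_sq' (by linarith [neg_abs_le r]) (le_trans (le_abs_self r) hr)
    have hr3 : r * ‖y‖ ^ 2 ≤ ‖p‖ * ‖y‖ * ‖y‖ ^ 2 :=
      mul_le_mul_of_nonneg_right (le_trans (le_abs_self r) hr) (by positivity)
    nlinarith [sq_nonneg (‖p‖ * ‖y‖ - ‖y‖ ^ 2)]
  have hI1 : Integrable (fun ω => ‖M ω‖ ^ 4 + 4 * (x ω * W ω).re) P :=
    hM.int.add (hxWi.re.const_mul 4)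
  have hI2 : Integrable (fun ω => ‖M ω‖ ^ 4 + 4 * (x ω * W ω).re
      + 8 * (‖x ω‖ ^ 2 * (‖M ω‖ ^ 2 * ‖Z ω‖ ^ 2))) P := hI1.add (hi2i.const_mul 8)
  have hI : Integrable (fun ω => ‖M ω‖ ^ 4 + 4 * (x ω * W ω).re
      + 8 * (‖x ω‖ ^ 2 * (‖M ω‖ ^ 2 * ‖Z ω‖ ^ 2)) + 3 * ‖x ω * Z ω‖ ^ 4) P :=
    hI2.add (hxZ.int.const_mul 3)
  have hmeas : Measurable (fun ω => M ω + x ω * Z ω) := hM.meas.add hxZ.meas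
  have hJ : Integrable (fun ω => ‖M ω + x ω * Z ω‖ ^ 4) P :=
    hI.mono' (hmeas.norm.pow_const 4).aestronglyMeasurable (ae_of_all _ fun ω => by
      rw [Real.norm_of_nonneg (by positivity)]; exact hpt ω)
  have haB : 0 ≤ a * B' := mul_nonneg hx.nonneg hZ.nonneg
  refine ⟨hmeas, by nlinarith [hM.nonneg], hJ, (integral_mono hJ hI hpt).trans ?_⟩
  have hre : Integrable (fun ω => 4 * (x ω * W ω).re) P := hxWi.re.const_mul 4
  rw [integral_add hI2 (hxZ.int.const_mul 3), integral_add hI1 (hi2i.const_mul 8),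
    integral_add hM.int hre, integral_const_mul, integral_const_mul, integral_const_mul, hxW]
  have := hM.le
  have := hxZ.le
  -- `B² + 8aBB' + 3a²B'² ≤ (B + 4aB')²`.
  nlinarith [hM.nonneg]

/-- Induction on the largest index: the terms before `p` are known at time `p`, while `x p` is
independent of `𝓕 p`. -/
theorem sum_martingale [IsProbabilityMeasure P] {κ : Type*} [LinearOrder κ] (s : Finset κ)
    {𝓕 : κ → MeasurableSpace Ω} (h𝓕 : ∀ p, 𝓕 p ≤ mΩ) (hmono : Monotone 𝓕)
    {x Z : κ → Ω → ℂ} {a : ℝ} {B : κ → ℝ} (hx : ∀ p, L4Bound P (x p) a)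
    (hx0 : ∀ p, ∫ ω, x p ω ∂P = 0)
    (hind : ∀ p, Indep (MeasurableSpace.comap (x p) inferInstance) (𝓕 p) P)
    (hxm : ∀ p q, q < p → Measurable[𝓕 p] (x q)) (hZm : ∀ p, Measurable[𝓕 p] (Z p))
    (hZ : ∀ p, L4Bound P (Z p) (B p)) :
    L4Bound P (fun ω => ∑ p ∈ s, x p ω * Z p ω) (4 * a * ∑ p ∈ s, B p) := by
  induction s using Finset.induction_on_max with
  | empty => simpa using L4Bound.const (P := P) 0
  | insert p s hs ih =>
    have hp : p ∉ s := fun h => lt_irrefl _ (hs p h)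
    have hM : Measurable[𝓕 p] (fun ω => ∑ q ∈ s, x q ω * Z q ω) :=
      Finset.measurable_sum s fun q hq =>
        (hxm p q (hs q hq)).mul ((hZm q).mono (hmono (hs q hq).le) le_rfl)
    have := add_indep_mul (h𝓕 p) ih (hx p) (hZ p) (hind p) (hx0 p) hM (hZm p)
    simp only [Finset.sum_insert hp]
    convert this using 1
    · ext ω; ring
    · ring

end L4Bound
end L4

/-! ### Multilinear forms in independent gains -/

section Chaos

variable {Ω ι : Type*} {mΩ : MeasurableSpace Ω} {P : Measure Ω} {X : ι → Ω → ℂ} {n : ℕ}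

/-- The σ-algebra generated by the variables `X i` with `i ∈ T`. -/
@[reducible]
def sig (X : ι → Ω → ℂ) (T : Set ι) : MeasurableSpace Ω :=
  ⨆ i ∈ T, MeasurableSpace.comap (X i) inferInstance

theorem measurable_sig {T : Set ι} {i : ι} (hi : i ∈ T) : Measurable[sig X T] (X i) :=
  (comap_measurable (X i)).mono
    (le_iSup₂ (f := fun i (_ : i ∈ T) => MeasurableSpace.comap (X i) inferInstance) i hi) le_rfl

theorem sig_mono {S T : Set ι} (h : S ⊆ T) : sig X S ≤ sig X T :=
  biSup_mono h

theorem sig_le (hX : ∀ i, Measurable (X i)) (T : Set ι) : sig X T ≤ mΩ :=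
  iSup₂_le fun i _ => (hX i).comap_le

theorem indep_sig (hX : ∀ i, Measurable (X i)) (hind : iIndepFun X P) {T : Set ι} {i : ι}
    (hi : i ∉ T) {φ : ℂ → ℂ} (hφ : Measurable φ) :
    Indep (MeasurableSpace.comap (fun ω => φ (X i ω)) inferInstance) (sig X T) P := by
  have h := indep_iSup_of_disjoint (fun i => (hX i).comap_le) hind.iIndep
    (Set.disjoint_singleton_left.2 hi)
  simp only [Set.mem_singleton_iff, iSup_iSup_eq_left] at h
  refine indep_of_indep_of_le_left h ?_
  change MeasurableSpace.comap (φ ∘ X i) _ ≤ _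
  rw [← MeasurableSpace.comap_comp]
  exact MeasurableSpace.comap_mono hφ.comap_le

theorem measurable_sig_union {T : Set ι} {κ : Type*} [LT κ] {e : κ → ι} {p q : κ} (h : p < q) :
    Measurable[sig X (T ∪ (e '' {r | r < q}))] (X (e p)) :=
  measurable_sig (Set.mem_union_right _ ⟨p, h, rfl⟩)

theorem measurable_conj_comp {m : MeasurableSpace Ω} {f : Ω → ℂ} (hf : Measurable[m] f) :
    Measurable[m] (fun ω => starRingEnd ℂ (f ω)) :=
  Complex.continuous_conj.measurable.comp hf

theorem measurable_sum_of_support {m : MeasurableSpace Ω} {κ : Type*} [Fintype κ]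
    {c : κ → ℂ} {x : κ → Ω → ℂ} (h : ∀ i, c i ≠ 0 → Measurable[m] (x i)) :
    Measurable[m] (fun ω => ∑ i, x i ω * c i) := by
  refine Finset.measurable_sum _ fun i _ => ?_
  by_cases hc : c i = 0
  · simp only [hc, mul_zero]; exact measurable_const
  · exact (h i hc).mul_const _

/-- The set `T` holds variables known before the chain starts. This allows conditioning on all gains
of one user while summing over those of another. -/
theorem L4Bound.sum_chain [IsProbabilityMeasure P] (hX : ∀ i, Measurable (X i))
    (hind : iIndepFun X P) {e : Fin n → ι} (he : Function.Injective e) {T : Set ι}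
    (hT : ∀ p, e p ∉ T) {φ : Fin n → ℂ → ℂ} (hφ : ∀ p, Measurable (φ p)) {a : ℝ}
    (hx : ∀ p, L4Bound P (fun ω => φ p (X (e p) ω)) a)
    (hx0 : ∀ p, ∫ ω, φ p (X (e p) ω) ∂P = 0) {Z : Fin n → Ω → ℂ} {B : Fin n → ℝ}
    (hZm : ∀ p, Measurable[sig X (T ∪ e '' Set.Iio p)] (Z p)) (hZ : ∀ p, L4Bound P (Z p) (B p)) :
    L4Bound P (fun ω => ∑ p, φ p (X (e p) ω) * Z p ω) (4 * a * ∑ p, B p) := by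
  refine L4Bound.sum_martingale (𝓕 := fun p => sig X (T ∪ e '' Set.Iio p))
    (x := fun p ω => φ p (X (e p) ω)) Finset.univ (fun p => sig_le hX _)
    (fun p q hpq => sig_mono (Set.union_subset_union_right _
      (Set.image_mono (Set.Iio_subset_Iio hpq)))) hx hx0 (fun p => ?_) (fun p q hqp => ?_) hZm hZ
  · refine indep_sig hX hind ?_ (hφ p)
    rintro (h | ⟨q, hq, h⟩)
    · exact hT p h
    · exact (ne_of_lt hq) (he h)
  · exact (hφ q).comp (measurable_sig (Or.inr ⟨q, hqp, rfl⟩))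

/-- The linear relation has at most one solution `i`; this is how the equal-lag constraint saves a
factor `n`. -/
theorem sum_ite_add_eq_le (c s : ℕ) {D : ℝ} (hD : 0 ≤ D) :
    ∑ i : Fin n, (if c = s + (i : ℕ) then D else 0) ≤ D := by
  rw [← Finset.sum_filter, Finset.sum_const, nsmul_eq_mul]
  have : ((Finset.univ.filter fun i : Fin n => c = s + (i : ℕ)).card : ℝ) ≤ 1 := by
    exact_mod_cast Finset.card_le_one.2 fun i hi j hj => by
      simp only [Finset.mem_filter, Finset.mem_univ, true_and] at hi hj
      ext; omega
  nlinarith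

/-- Independent centred complex variables `X i` with `E |X i|² = v i`, whose eighth moments
are bounded in terms of `A`. -/
structure Gains (P : Measure Ω) (X : ι → Ω → ℂ) (v : ι → ℝ) (A : ℝ) : Prop where
  meas : ∀ i, Measurable (X i)
  indep : iIndepFun X P
  one_le : 1 ≤ A
  mean : ∀ i, ∫ ω, X i ω ∂P = 0
  bound : ∀ i, L4Bound P (X i) A
  bound_sq : ∀ i, L4Bound P (fun ω => ((‖X i ω‖ ^ 2 : ℝ) : ℂ)) A
  mean_sq : ∀ i, ∫ ω, (((‖X i ω‖ ^ 2 : ℝ) : ℂ) - (v i : ℂ)) ∂P = 0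
  bound_sub : ∀ i, L4Bound P (fun ω => ((‖X i ω‖ ^ 2 : ℝ) : ℂ) - (v i : ℂ)) A
  var_le : ∀ i, ‖v i‖ ^ 2 ≤ A

namespace Gains

variable {v : ι → ℝ} {A : ℝ}

theorem nonneg (h : Gains P X v A) : 0 ≤ A := zero_le_one.trans h.one_le

theorem mean_conj [IsProbabilityMeasure P] (h : Gains P X v A) (i : ι) :
    ∫ ω, starRingEnd ℂ (X i ω) ∂P = 0 := by
  rw [integral_conj, h.mean, map_zero]

theorem precomp {ι' : Type*} (h : Gains P X v A) {e : ι' → ι} (he : Function.Injective e) :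
    Gains P (fun i => X (e i)) (fun i => v (e i)) A :=
  ⟨fun _ => h.meas _, h.indep.precomp he, h.one_le, fun _ => h.mean _, fun _ => h.bound _,
    fun _ => h.bound_sq _, fun _ => h.mean_sq _, fun _ => h.bound_sub _, fun _ => h.var_le _⟩

theorem sum_mul [IsProbabilityMeasure P] (h : Gains P X v A) {e : Fin n → ι}
    (he : Function.Injective e) {T : Set ι} (hT : ∀ p, e p ∉ T) {Z : Fin n → Ω → ℂ} {B : Fin n → ℝ}
    (hZm : ∀ p, Measurable[sig X (T ∪ e '' Set.Iio p)] (Z p)) (hZ : ∀ p, L4Bound P (Z p) (B p)) :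
    L4Bound P (fun ω => ∑ p, X (e p) ω * Z p ω) (4 * A * ∑ p, B p) :=
  L4Bound.sum_chain h.meas h.indep he hT (φ := fun _ z => z) (fun _ => measurable_id)
    (fun _ => h.bound _) (fun _ => h.mean _) hZm hZ

theorem sum_conj_mul [IsProbabilityMeasure P] (h : Gains P X v A) {e : Fin n → ι}
    (he : Function.Injective e) {T : Set ι} (hT : ∀ p, e p ∉ T) {Z : Fin n → Ω → ℂ} {B : Fin n → ℝ}
    (hZm : ∀ p, Measurable[sig X (T ∪ e '' Set.Iio p)] (Z p)) (hZ : ∀ p, L4Bound P (Z p) (B p)) :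
    L4Bound P (fun ω => ∑ p, starRingEnd ℂ (X (e p) ω) * Z p ω) (4 * A * ∑ p, B p) :=
  L4Bound.sum_chain h.meas h.indep he hT (φ := fun _ z => starRingEnd ℂ z)
    (fun _ => Complex.continuous_conj.measurable)
    (fun _ => (h.bound _).conj) (fun _ => h.mean_conj _) hZm hZ

/-- Linear forms supported on at most one index. -/
theorem sum_mul_const_of_support [IsProbabilityMeasure P] (h : Gains P X v A) {e : Fin n → ι}
    (he : Function.Injective e) {κ : Fin n → ℂ} {D : ℝ} (hκ : ∀ i, ‖κ i‖ ≤ D) {c s : ℕ}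
    (hs : ∀ i, κ i ≠ 0 → c = s + (i : ℕ)) :
    L4Bound P (fun ω => ∑ i, X (e i) ω * κ i) (4 * A * D ^ 2) := by
  refine (h.sum_mul he (T := ∅) (fun _ => id) (Z := fun i _ => κ i)
    (fun i => measurable_const) (fun i => L4Bound.const (κ i))).mono ?_
  refine mul_le_mul_of_nonneg_left ?_ (by linarith [h.one_le])
  refine le_trans (Finset.sum_le_sum fun i _ => ?_) (sum_ite_add_eq_le (n := n) c s (sq_nonneg D))
  split_ifs with hi
  · exact pow_le_pow_left₀ (norm_nonneg _) (hκ i) 2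
  · have : κ i = 0 := by by_contra h0; exact hi (hs i h0)
    simp [this]

/-- Under `i < p < q < s` each of the four nested sums is a martingale transform and costs a factor
`4 * A`. The relation leaves at most one `i` for given `s, q, p`, so only three sums contribute a
factor `n`. -/
theorem quadrilinear [IsProbabilityMeasure P] {X : Fin n → Ω → ℂ} {v : Fin n → ℝ}
    (h : Gains P X v A) {κ : Fin n → Fin n → Fin n → Fin n → ℂ} {D : ℝ}
    (hκ : ∀ s q p i, ‖κ s q p i‖ ≤ D)
    (hs : ∀ s q p i, κ s q p i ≠ 0 → i < p ∧ p < q ∧ q < s ∧ (p : ℕ) + q = s + i) :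
    L4Bound P (fun ω => ∑ s, ∑ q, ∑ p, ∑ i, κ s q p i *
      (X s ω * starRingEnd ℂ (X q ω) * starRingEnd ℂ (X p ω) * X i ω))
      (256 * A ^ 4 * D ^ 2 * n ^ 3) := by
  have inj : Function.Injective (id : Fin n → Fin n) := Function.injective_id
  have hW : ∀ s q p, L4Bound P (fun ω => ∑ i, X i ω * κ s q p i) (4 * A * D ^ 2) := fun s q p =>
    h.sum_mul_const_of_support inj (hκ s q p) fun i hi => (hs s q p i hi).2.2.2
  have hWm : ∀ s q p, Measurable[sig X (∅ ∪ id '' Set.Iio p)]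
      (fun ω => ∑ i, X i ω * κ s q p i) := fun s q p =>
    measurable_sum_of_support fun i hi => measurable_sig_union (e := id) (hs s q p i hi).1
  have hY := fun s q => h.sum_conj_mul inj (T := ∅) (fun _ => id) (hWm s q) (hW s q)
  have hYm : ∀ s q, Measurable[sig X (∅ ∪ id '' Set.Iio q)]
      (fun ω => ∑ p, starRingEnd ℂ (X p ω) * ∑ i, X i ω * κ s q p i) := fun s q => by
    refine Finset.measurable_sum _ fun p _ => ?_
    by_cases hpq : p < q
    · exact (measurable_conj_comp (measurable_sig_union (e := id) hpq)).mul
        ((hWm s q p).mono (sig_mono (Set.union_subset_union_right _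
          (Set.image_mono (Set.Iio_subset_Iio hpq.le)))) le_rfl)
    · have : ∀ i, κ s q p i = 0 := fun i => by
        by_contra h0; exact hpq (hs s q p i h0).2.1
      simp only [this, mul_zero, Finset.sum_const_zero]
      exact measurable_const
  have hV := fun s => h.sum_conj_mul inj (T := ∅) (fun _ => id) (hYm s) (hY s)
  have hVm : ∀ s, Measurable[sig X (∅ ∪ id '' Set.Iio s)]
      (fun ω => ∑ q, starRingEnd ℂ (X q ω) *
        ∑ p, starRingEnd ℂ (X p ω) * ∑ i, X i ω * κ s q p i) := fun s => by
    refine Finset.measurable_sum _ fun q _ => ?_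
    by_cases hqs : q < s
    · exact (measurable_conj_comp (measurable_sig_union (e := id) hqs)).mul
        ((hYm s q).mono (sig_mono (Set.union_subset_union_right _
          (Set.image_mono (Set.Iio_subset_Iio hqs.le)))) le_rfl)
    · have : ∀ p i, κ s q p i = 0 := fun p i => by
        by_contra h0; exact hqs (hs s q p i h0).2.2.1
      simp only [this, mul_zero, Finset.sum_const_zero]
      exact measurable_const
  have hU := h.sum_mul inj (T := ∅) (fun _ => id) hVm hV
  convert hU using 1
  · ext ω
    simp only [Finset.mul_sum, id]
    refine Finset.sum_congr rfl fun s _ => Finset.sum_congr rfl fun q _ =>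
      Finset.sum_congr rfl fun p _ => Finset.sum_congr rfl fun i _ => by ring
  · simp only [Finset.sum_const, Finset.card_univ, Fintype.card_fin, nsmul_eq_mul]
    ring

/-- The coincidence `p = q` of the quadrilinear form. There is one free index fewer, so the sum over
`q` may be bounded crudely, at cost `n ^ 2`, and the total is still of order `n ^ 3`. -/
theorem trilinear [IsProbabilityMeasure P] {X : Fin n → Ω → ℂ} {v : Fin n → ℝ}
    (h : Gains P X v A) {κ : Fin n → Fin n → Fin n → ℂ} {D : ℝ}
    (hκ : ∀ s q i, ‖κ s q i‖ ≤ D)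
    (hs : ∀ s q i, κ s q i ≠ 0 → i < q ∧ q < s ∧ (q : ℕ) + q = s + i) :
    L4Bound P (fun ω => ∑ s, ∑ q, ∑ i, κ s q i *
      (X s ω * starRingEnd ℂ (X q ω) * starRingEnd ℂ (X q ω) * X i ω))
      (256 * A ^ 4 * D ^ 2 * n ^ 3) := by
  have inj : Function.Injective (id : Fin n → Fin n) := Function.injective_id
  have hW : ∀ s q, L4Bound P (fun ω => ∑ i, X i ω * κ s q i) (4 * A * D ^ 2) := fun s q =>
    h.sum_mul_const_of_support inj (hκ s q) fun i hi => (hs s q i hi).2.2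
  have hWm : ∀ s q, Measurable[sig X (∅ ∪ id '' Set.Iio q)]
      (fun ω => ∑ i, X i ω * κ s q i) := fun s q =>
    measurable_sum_of_support fun i hi => measurable_sig_union (e := id) (hs s q i hi).1
  have hφ : Measurable fun z : ℂ => starRingEnd ℂ z * starRingEnd ℂ z :=
    Complex.continuous_conj.measurable.mul Complex.continuous_conj.measurable
  have hY : ∀ s q, L4Bound P (fun ω => (starRingEnd ℂ (X q ω) * starRingEnd ℂ (X q ω)) *
      ∑ i, X i ω * κ s q i) (A * (4 * A * D ^ 2)) := fun s q =>
    L4Bound.indep_mul ((h.bound_sq q).of_norm_le (hφ.comp (h.meas q)) fun ω => by simp [pow_two])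
      (hW s q) (indep_sig (φ := fun z => starRingEnd ℂ z * starRingEnd ℂ z) h.meas h.indep
        (by simp) hφ) (hWm s q)
  have hV := fun s => L4Bound.sum (P := P) Finset.univ (by have := h.nonneg; positivity)
    fun q _ => hY s q
  have hVm : ∀ s, Measurable[sig X (∅ ∪ id '' Set.Iio s)]
      (fun ω => ∑ q, (starRingEnd ℂ (X q ω) * starRingEnd ℂ (X q ω)) *
        ∑ i, X i ω * κ s q i) := fun s => by
    refine Finset.measurable_sum _ fun q _ => ?_
    by_cases hqs : q < s
    · exact (hφ.comp (measurable_sig_union (e := id) hqs)).mul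
        ((hWm s q).mono (sig_mono (Set.union_subset_union_right _
          (Set.image_mono (Set.Iio_subset_Iio hqs.le)))) le_rfl)
    · have : ∀ i, κ s q i = 0 := fun i => by
        by_contra h0; exact hqs (hs s q i h0).2.1
      simp only [this, mul_zero, Finset.sum_const_zero]
      exact measurable_const
  have hU := (h.sum_mul inj (T := ∅) (fun _ => id) hVm hV).mono
    (B' := 256 * A ^ 4 * D ^ 2 * n ^ 3) (by
      simp only [Finset.sum_const, Finset.card_univ, Fintype.card_fin, nsmul_eq_mul]
      have h1 : A ^ 3 ≤ A ^ 4 := pow_le_pow_right₀ h.one_le (by norm_num)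
      have h2 : 0 ≤ D ^ 2 * (n : ℝ) ^ 3 := by positivity
      have h3 : 0 ≤ A ^ 4 := by have := h.nonneg; positivity
      nlinarith [mul_le_mul_of_nonneg_right h1 h2, mul_nonneg h3 h2])
  convert hU using 1
  ext ω
  simp only [Finset.mul_sum, id]
  refine Finset.sum_congr rfl fun s _ => Finset.sum_congr rfl fun q _ =>
    Finset.sum_congr rfl fun i _ => by ring

/-- Off-diagonal part of an autocorrelation energy. -/
theorem autocorrelation [IsProbabilityMeasure P] {X : Fin n → Ω → ℂ} {v : Fin n → ℝ}
    (h : Gains P X v A) {κ : Fin n → Fin n → Fin n → Fin n → ℂ} {D : ℝ}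
    (hκ : ∀ s q p i, ‖κ s q p i‖ ≤ D)
    (hs : ∀ s q p i, κ s q p i ≠ 0 → i < p ∧ i < q ∧ (p : ℕ) + q = s + i) :
    L4Bound P (fun ω => ∑ s, ∑ q, ∑ p, ∑ i, κ s q p i *
      (X s ω * starRingEnd ℂ (X q ω) * starRingEnd ℂ (X p ω) * X i ω))
      (10000 * A ^ 4 * D ^ 2 * n ^ 3) := by
  have hD : ∀ (b : Prop) [Decidable b] s q p i, ‖if b then κ s q p i else 0‖ ≤ D := by
    intro b _ s q p i
    split_ifs
    · exact hκ s q p i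
    · simpa using (norm_nonneg _).trans (hκ s q p i)
  -- The relation together with `i < p` and `i < q` makes `s` the largest index. Only the order of
  -- `p` and `q` is undecided: `p < q`, `q < p` (exchange their roles) or `p = q`.
  have h1 := h.quadrilinear (κ := fun s q p i => if p < q then κ s q p i else 0)
    (fun s q p i => hD _ s q p i) (fun s q p i hne => by
      obtain ⟨h1, h2⟩ := ite_ne_right_iff.1 hne
      obtain ⟨h3, h4, h5⟩ := hs s q p i h2
      refine ⟨h3, h1, ?_, h5⟩
      simp only [Fin.lt_def] at *; omega)
  have h2 := h.quadrilinear (κ := fun s q p i => if p < q then κ s p q i else 0)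
    (fun s q p i => hD _ s p q i) (fun s q p i hne => by
      obtain ⟨h1, h2⟩ := ite_ne_right_iff.1 hne
      obtain ⟨h3, h4, h5⟩ := hs s p q i h2
      refine ⟨h4, h1, ?_, by omega⟩
      simp only [Fin.lt_def] at *; omega)
  have h3 := h.trilinear (κ := fun s q i => κ s q q i)
    (fun s q i => hκ s q q i) (fun s q i hne => by
      obtain ⟨h3, h4, h5⟩ := hs s q q i hne
      refine ⟨h3, ?_, h5⟩
      simp only [Fin.lt_def] at *; omega)
  -- `4 * (4 * (256 + 256) + 256) = 9216 ≤ 10000`.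
  refine L4Bound.mono (B := 4 * (4 * (256 * A ^ 4 * D ^ 2 * n ^ 3 + 256 * A ^ 4 * D ^ 2 * n ^ 3)
    + 256 * A ^ 4 * D ^ 2 * n ^ 3)) ?_ (by
      have : 0 ≤ A ^ 4 * D ^ 2 * (n : ℝ) ^ 3 := by have := h.nonneg; positivity
      linarith)
  convert (h1.add h2).add h3 using 1
  ext ω
  rw [← Finset.sum_add_distrib, ← Finset.sum_add_distrib]
  refine Finset.sum_congr rfl fun s _ => ?_
  conv_rhs => enter [1, 2]; rw [Finset.sum_comm]
  rw [← Finset.sum_add_distrib, ← Finset.sum_add_distrib]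
  refine Finset.sum_congr rfl fun q _ => ?_
  have e3 : ∑ i, κ s q q i * (X s ω * starRingEnd ℂ (X q ω) * starRingEnd ℂ (X q ω) * X i ω)
      = ∑ p, ∑ i, (if p = q then κ s q p i else 0) *
        (X s ω * starRingEnd ℂ (X q ω) * starRingEnd ℂ (X p ω) * X i ω) := by
    refine Eq.trans ?_ (Finset.sum_eq_single q (fun p _ hp => by
      simp only [hp, if_false, zero_mul, Finset.sum_const_zero]) (by simp)).symm
    simp only [if_true]
  rw [e3, ← Finset.sum_add_distrib, ← Finset.sum_add_distrib]
  refine Finset.sum_congr rfl fun p _ => ?_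
  rw [← Finset.sum_add_distrib, ← Finset.sum_add_distrib]
  refine Finset.sum_congr rfl fun i _ => ?_
  rcases lt_trichotomy p q with hpq | hpq | hpq
  · simp [hpq, hpq.not_gt, hpq.ne]
  · simp [hpq]
  · simp only [hpq, hpq.not_gt, hpq.ne', if_true, if_false]; ring

/-- Off-diagonal part of a cross-correlation energy. -/
theorem crosscorrelation [IsProbabilityMeasure P] {e f : Fin n → ι}
    (h : Gains P X v A) (he : Function.Injective e) (hf : Function.Injective f)
    (hef : ∀ i j, e i ≠ f j) {κ : Fin n → Fin n → Fin n → Fin n → ℂ} {D : ℝ}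
    (hκ : ∀ s q p i, ‖κ s q p i‖ ≤ D)
    (hs : ∀ s q p i, κ s q p i ≠ 0 → q < s ∧ i < p ∧ (i : ℕ) + s = p + q) :
    L4Bound P (fun ω => ∑ s, ∑ q, ∑ p, ∑ i, κ s q p i *
      (starRingEnd ℂ (X (e s) ω) * X (e q) ω * X (f p) ω * starRingEnd ℂ (X (f i) ω)))
      (256 * A ^ 4 * D ^ 2 * n ^ 3) := by
  have hW : ∀ s q p, L4Bound P (fun ω => ∑ i, starRingEnd ℂ (X (f i) ω) * κ s q p i)
      (4 * A * D ^ 2) := fun s q p => by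
    have := (h.sum_mul_const_of_support hf (κ := fun i => starRingEnd ℂ (κ s q p i))
      (fun i => (RCLike.norm_conj _).trans_le (hκ s q p i)) (c := p + q) (s := s) fun i hi => by
        have := (hs s q p i (by simpa using hi)).2.2; omega).conj
    simpa [map_sum] using this
  have hWm : ∀ s q p, Measurable[sig X (∅ ∪ f '' Set.Iio p)]
      (fun ω => ∑ i, starRingEnd ℂ (X (f i) ω) * κ s q p i) := fun s q p =>
    measurable_sum_of_support (x := fun i ω => starRingEnd ℂ (X (f i) ω)) fun i hi =>
      Complex.continuous_conj.measurable.comp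
        (measurable_sig (Or.inr ⟨i, (hs s q p i hi).2.1, rfl⟩))
  have hY := fun s q => h.sum_mul hf (T := ∅) (fun _ => id) (hWm s q) (hW s q)
  -- All gains `X (f p)` are put into the base σ-algebra, so that the chain over `e` can treat the
  -- inner sums over `f` as known.
  have hYm : ∀ s q, Measurable[sig X (Set.range f ∪ e '' Set.Iio q)]
      (fun ω => ∑ p, X (f p) ω * ∑ i, starRingEnd ℂ (X (f i) ω) * κ s q p i) := fun s q => by
    refine Finset.measurable_sum _ fun p _ => (measurable_sig
      (Set.mem_union_left (e '' Set.Iio q) (Set.mem_range_self p))).mul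
      ((hWm s q p).mono (sig_mono ?_) le_rfl)
    rintro _ (⟨⟨⟩⟩ | ⟨i, -, rfl⟩)
    exact Or.inl ⟨i, rfl⟩
  have hT : ∀ p, e p ∉ Set.range f := by rintro p ⟨j, hj⟩; exact hef p j hj.symm
  have hV := fun s => h.sum_mul he hT (hYm s) (hY s)
  have hVm : ∀ s, Measurable[sig X (Set.range f ∪ e '' Set.Iio s)]
      (fun ω => ∑ q, X (e q) ω *
        ∑ p, X (f p) ω * ∑ i, starRingEnd ℂ (X (f i) ω) * κ s q p i) := fun s => by
    refine Finset.measurable_sum _ fun q _ => ?_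
    by_cases hqs : q < s
    · exact (measurable_sig_union hqs).mul
        ((hYm s q).mono (sig_mono (Set.union_subset_union_right _
          (Set.image_mono (Set.Iio_subset_Iio hqs.le)))) le_rfl)
    · have : ∀ p i, κ s q p i = 0 := fun p i => by
        by_contra h0; exact hqs (hs s q p i h0).1
      simp only [this, mul_zero, Finset.sum_const_zero]
      exact measurable_const
  have hU := h.sum_conj_mul he hT hVm hV
  convert hU using 1
  · ext ω
    simp only [Finset.mul_sum]
    refine Finset.sum_congr rfl fun s _ => Finset.sum_congr rfl fun q _ =>
      Finset.sum_congr rfl fun p _ => Finset.sum_congr rfl fun i _ => by ring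
  · simp only [Finset.sum_const, Finset.card_univ, Fintype.card_fin, nsmul_eq_mul]
    ring

/-- The centred squares `‖X p‖ ^ 2 - v p` are themselves independent and centred, so they can drive
a chain; this is what requires eighth moments of the gains. -/
theorem sum_sub_var [IsProbabilityMeasure P] {X : Fin n → Ω → ℂ} {v : Fin n → ℝ}
    (h : Gains P X v A) {Z : Fin n → Ω → ℂ} {B : ℝ}
    (hZm : ∀ p, Measurable[sig X (Set.Iio p)] (Z p)) (hZ : ∀ p, L4Bound P (Z p) B) :
    L4Bound P (fun ω => ∑ p, (((‖X p ω‖ ^ 2 : ℝ) : ℂ) - (v p : ℂ)) * Z p ω) (4 * A * (n * B)) := by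
  have := L4Bound.sum_chain h.meas h.indep (e := id) Function.injective_id (T := ∅) (fun _ => id)
    (φ := fun p z => ((‖z‖ ^ 2 : ℝ) : ℂ) - (v p : ℂ)) (fun p => by fun_prop)
    (fun p => h.bound_sub p) (fun p => h.mean_sq p) (fun p => by
      rw [show ∅ ∪ id '' Set.Iio p = Set.Iio p by simp]; exact hZm p) hZ
  simpa using this

/-- Diagonal part of an autocorrelation energy. -/
theorem diagonal [IsProbabilityMeasure P] {X : Fin n → Ω → ℂ} {v : Fin n → ℝ}
    (h : Gains P X v A) {κ : Fin n → Fin n → ℂ} {D : ℝ} (hκ : ∀ i j, ‖κ i j‖ ≤ D)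
    (hs : ∀ i j, κ i j ≠ 0 → i < j) :
    L4Bound P (fun ω => ∑ i, ∑ j, κ i j * (((‖X i ω‖ ^ 2 : ℝ) : ℂ) * ((‖X j ω‖ ^ 2 : ℝ) : ℂ)
      - (v i : ℂ) * (v j : ℂ))) (32 * A ^ 2 * D ^ 2 * n ^ 3) := by
  have hA := h.nonneg
  have hsq : ∀ i j, ‖κ i j‖ ^ 2 ≤ D ^ 2 := fun i j => pow_le_pow_left₀ (norm_nonneg _) (hκ i j) 2
  -- Write `xᵢxⱼ - vᵢvⱼ = xᵢ(xⱼ - vⱼ) + (xᵢ - vᵢ)vⱼ` with `xᵢ = ‖X i‖²`. Since `i < j`, the first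
  -- part is a martingale in `j`; the second is one in `i`, with constant coefficients.
  have h1 := h.sum_sub_var (Z := fun j ω => ∑ i, ((‖X i ω‖ ^ 2 : ℝ) : ℂ) * κ i j)
    (B := (n : ℝ) ^ 2 * (D ^ 2 * A))
    (fun j => measurable_sum_of_support (x := fun i ω => ((‖X i ω‖ ^ 2 : ℝ) : ℂ)) fun i hi =>
      (by fun_prop : Measurable fun z : ℂ => ((‖z‖ ^ 2 : ℝ) : ℂ)).comp
        (measurable_sig (hs i j hi)))
    (fun j => by
      have := L4Bound.sum (P := P) Finset.univ (B := D ^ 2 * A) (by positivity) fun i _ =>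
        ((h.bound_sq i).const_mul (κ i j)).mono (mul_le_mul_of_nonneg_right (hsq i j) hA)
      simpa [mul_comm] using this)
  have h2 := h.sum_sub_var (Z := fun i _ => ∑ j, κ i j * (v j : ℂ))
    (B := (n : ℝ) ^ 2 * (D ^ 2 * A)) (fun i => measurable_const)
    (fun i => by
      have := L4Bound.sum (P := P) (f := fun j (_ : Ω) => κ i j * (v j : ℂ)) Finset.univ
        (B := D ^ 2 * A) (by positivity) fun j _ =>
        (L4Bound.const (κ i j * (v j : ℂ))).mono (by
          rw [norm_mul, mul_pow, Complex.norm_real]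
          exact mul_le_mul (hsq i j) (h.var_le j) (by positivity) (by positivity))
      simpa using this)
  convert h1.add h2 using 1
  · ext ω
    simp only [Finset.mul_sum]
    rw [Finset.sum_comm (f := fun p i => ((((‖X p ω‖ ^ 2 : ℝ) : ℂ) - (v p : ℂ)) *
      (((‖X i ω‖ ^ 2 : ℝ) : ℂ) * κ i p))), ← Finset.sum_add_distrib]
    refine Finset.sum_congr rfl fun i _ => ?_
    rw [← Finset.sum_add_distrib]
    exact Finset.sum_congr rfl fun j _ => by ring
  · ring

end Gains
end Chaos

/-! ### Interference energies as quadrilinear forms -/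

section Energy

theorem sqNorm_eq {m : ℕ} (v : Fin m → ℂ) : sqNorm v = ∑ i, ‖v i‖ ^ 2 := by
  rw [sqNorm, EuclideanSpace.norm_sq_eq]

/-- The indicator of the fingers of a partial-Rake. -/
def finger (LP l : ℕ) : ℝ := if l < LP then 1 else 0

theorem finger_nonneg (LP l : ℕ) : 0 ≤ finger LP l := by unfold finger; split_ifs <;> norm_num

theorem finger_le_one (LP l : ℕ) : finger LP l ≤ 1 := by unfold finger; split_ifs <;> norm_num

theorem rake_apply {L : ℕ} (LP : ℕ) (a : Fin L → ℂ) (l : Fin L) :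
    rake L LP a l = (finger LP l : ℂ) * a l := by
  rw [rake, procMatrix, Matrix.mulVec_diagonal, finger]
  by_cases h : (l : ℕ) < LP
  · simp [h]
  · simp [h]

theorem hSP_rake {L : ℕ} (LP : ℕ) (a : Fin L → ℂ) :
    hSP (rake L LP a) a = ∑ l : Fin L, finger LP l * ‖a l‖ ^ 2 := by
  rw [hSP, dotProduct, Complex.re_sum]
  refine Finset.sum_congr rfl fun l _ => ?_
  rw [Pi.star_apply, rake_apply, star_mul', mul_assoc, Complex.star_def,
    ← Complex.normSq_eq_conj_mul_self, Complex.conj_ofReal, ← Complex.ofReal_mul,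
    Complex.ofReal_re, Complex.normSq_eq_norm_sq]

/-- Indicator of the pairs of paths that meet in column `m` of the shift matrix. -/
def meet {L : ℕ} (m : Fin (L - 1)) (i j : Fin L) : ℝ :=
  if (j : ℕ) + m + 1 = L + i then 1 else 0

/-- Column `m` collects the pairs of lag `j - i = L - (m + 1)`, so the product is a correlation of
the two vectors at that lag. -/
theorem shiftMatrix_conjTranspose_mulVec {L : ℕ} (b a : Fin L → ℂ) (m : Fin (L - 1)) :
    ((shiftMatrix b)ᴴ *ᵥ a) m
      = ∑ i, ∑ j, (meet m i j : ℂ) * (starRingEnd ℂ (b j) * a i) := by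
  rw [Matrix.mulVec, dotProduct]
  refine Finset.sum_congr rfl fun i _ => ?_
  rw [Matrix.conjTranspose_apply, shiftMatrix]
  have hm := m.isLt
  have hi := i.isLt
  split_ifs with h
  · rw [Finset.sum_eq_single (⟨L - 1 - (m : ℕ) + (i : ℕ), by omega⟩ : Fin L)]
    · have : meet m i ⟨L - 1 - (m : ℕ) + (i : ℕ), by omega⟩ = 1 := by
        rw [meet, if_pos]; simp only; omega
      rw [this]; simp
    · intro j _ hj
      have : meet m i j = 0 := by
        rw [meet, if_neg]; intro h'; apply hj; ext; simp only; omega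
      rw [this]; simp
    · simp
  · rw [Finset.sum_eq_zero]
    · simp
    · intro j _
      have hj := j.isLt
      have : meet m i j = 0 := by
        rw [meet, if_neg]; omega
      rw [this]; simp

theorem sum_mul_norm_sq {μ ι κ : Type*} [Fintype μ] [Fintype ι] [Fintype κ] (w : μ → ℝ)
    (I : μ → ι → κ → ℝ) (z : ι → κ → ℂ) :
    ((∑ m, w m * ‖∑ i, ∑ j, (I m i j : ℂ) * z i j‖ ^ 2 : ℝ) : ℂ)
      = ∑ i, ∑ i', ∑ j, ∑ j', ((∑ m, w m * (I m i j * I m i' j') : ℝ) : ℂ) *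
          (z i j * starRingEnd ℂ (z i' j')) := by
  have h : ∀ m, ((w m * ‖∑ i, ∑ j, (I m i j : ℂ) * z i j‖ ^ 2 : ℝ) : ℂ)
      = ∑ i, ∑ i', ∑ j, ∑ j', ((w m * (I m i j * I m i' j') : ℝ) : ℂ) *
          (z i j * starRingEnd ℂ (z i' j')) := by
    intro m
    rw [Complex.ofReal_mul, ← Complex.normSq_eq_norm_sq, Complex.normSq_eq_conj_mul_self, mul_comm
      (starRingEnd ℂ _), map_sum, Finset.sum_mul_sum, Finset.mul_sum]
    refine Finset.sum_congr rfl fun i _ => ?_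
    rw [Finset.mul_sum]
    refine Finset.sum_congr rfl fun i' _ => ?_
    rw [map_sum, Finset.sum_mul_sum, Finset.mul_sum]
    refine Finset.sum_congr rfl fun j _ => ?_
    rw [Finset.mul_sum]
    refine Finset.sum_congr rfl fun j' _ => ?_
    rw [map_mul, Complex.conj_ofReal]
    push_cast
    ring
  rw [Complex.ofReal_sum, Finset.sum_congr rfl fun m _ => h m, Finset.sum_comm]
  refine Finset.sum_congr rfl fun i _ => ?_
  rw [Finset.sum_comm]
  refine Finset.sum_congr rfl fun i' _ => ?_
  rw [Finset.sum_comm]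
  refine Finset.sum_congr rfl fun j _ => ?_
  rw [Finset.sum_comm]
  refine Finset.sum_congr rfl fun j' _ => ?_
  rw [Complex.ofReal_sum, Finset.sum_mul]

theorem sum_meet {L : ℕ} (W : ℕ → ℝ) (i j : Fin L) :
    ∑ m : Fin (L - 1), W (L - (m + 1)) * meet m i j
      = if i < j then W ((j : ℕ) - i) else 0 := by
  have hj := j.isLt
  split_ifs with h
  · rw [Fin.lt_def] at h
    rw [Finset.sum_eq_single (⟨L - 1 - (j - i), by omega⟩ : Fin (L - 1))]
    · rw [meet, if_pos (by simp only; omega), mul_one]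
      congr 1; simp only; omega
    · intro m _ hm
      rw [meet, if_neg, mul_zero]
      intro h'; apply hm; ext; simp only; omega
    · simp
  · rw [Fin.lt_def] at h
    refine Finset.sum_eq_zero fun m _ => ?_
    have := m.isLt
    rw [meet, if_neg (by omega), mul_zero]

/-- Two pairs meet in the same column exactly when their lags agree; this is the source of the
linear relation between the four indices. -/
theorem meet_mul_meet {L : ℕ} (m : Fin (L - 1)) (i j i' j' : Fin L) :
    meet m i j * meet m i' j' = if (j : ℕ) + i' = j' + i then meet m i j else 0 := by
  unfold meet
  split_ifs <;> first | omega | norm_num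

theorem sum_meet_mul_meet {L : ℕ} (W : ℕ → ℝ) (i j i' j' : Fin L) :
    ∑ m : Fin (L - 1), W (L - (m + 1)) * (meet m i j * meet m i' j')
      = if (j : ℕ) + i' = j' + i then (if i < j then W ((j : ℕ) - i) else 0) else 0 := by
  simp only [meet_mul_meet]
  split_ifs with h h'
  · rw [sum_meet, if_pos h']
  · rw [sum_meet, if_neg h']
  · simp

/-- Reduces the off-diagonal part to `i < i'`, the ordering that the martingale bounds need; the
other half is its conjugate. -/
theorem sum_hermitian {n : ℕ} (f : Fin n → Fin n → ℂ)
    (hf : ∀ i i', f i' i = starRingEnd ℂ (f i i')) :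
    ∑ i, ∑ i', f i i' = ∑ i, f i i + ∑ i, ∑ i', (if i < i' then f i i' else 0)
      + starRingEnd ℂ (∑ i, ∑ i', (if i < i' then f i i' else 0)) := by
  have h1 : starRingEnd ℂ (∑ i, ∑ i', (if i < i' then f i i' else 0))
      = ∑ i, ∑ i', (if i' < i then f i i' else 0) := by
    rw [map_sum, Finset.sum_comm]
    simp only [map_sum]
    rw [Finset.sum_comm]
    rw [Finset.sum_comm]
    refine Finset.sum_congr rfl fun i _ => Finset.sum_congr rfl fun i' _ => ?_
    split_ifs
    · exact (hf _ _).symm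
    · exact map_zero _
  have h2 : ∑ i, f i i = ∑ i, ∑ i', (if i = i' then f i i' else 0) := by simp
  rw [h1, h2, ← Finset.sum_add_distrib, ← Finset.sum_add_distrib]
  refine Finset.sum_congr rfl fun i _ => ?_
  rw [← Finset.sum_add_distrib, ← Finset.sum_add_distrib]
  refine Finset.sum_congr rfl fun i' _ => ?_
  rcases lt_trichotomy i i' with h | h | h
  · simp [h, h.ne, h.not_gt]
  · simp [h]
  · simp [h, h.ne', h.not_gt]

theorem sum_comm₄ {α : Type*} [Fintype α] (f : α → α → α → α → ℂ) :
    ∑ a, ∑ b, ∑ c, ∑ d, f a b c d = ∑ d, ∑ b, ∑ c, ∑ a, f a b c d := by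
  calc ∑ a, ∑ b, ∑ c, ∑ d, f a b c d = ∑ b, ∑ c, ∑ a, ∑ d, f a b c d := by
        rw [Finset.sum_comm]
        exact Finset.sum_congr rfl fun b _ => Finset.sum_comm
    _ = ∑ b, ∑ c, ∑ d, ∑ a, f a b c d :=
        Finset.sum_congr rfl fun b _ => Finset.sum_congr rfl fun c _ => Finset.sum_comm
    _ = ∑ b, ∑ d, ∑ c, ∑ a, f a b c d := Finset.sum_congr rfl fun b _ => Finset.sum_comm
    _ = _ := Finset.sum_comm

/-- The energy of the self-interference. -/
def siEnergy {L : ℕ} (LP Nc : ℕ) (a : Fin L → ℂ) : ℝ :=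
  sqNorm (phiMatrix L Nc *ᵥ ((shiftMatrix (rake L LP a))ᴴ *ᵥ a
    + (shiftMatrix a)ᴴ *ᵥ rake L LP a))

/-- The energy of the multiple access interference. -/
def maiEnergy {L : ℕ} (LP : ℕ) (b a : Fin L → ℂ) : ℝ :=
  sqNorm ((shiftMatrix (rake L LP b))ᴴ *ᵥ a) + sqNorm ((shiftMatrix a)ᴴ *ᵥ rake L LP b)
    + ‖star (rake L LP b) ⬝ᵥ a‖ ^ 2

/-- The weight of lag `d` in the self-interference. -/
def lagWeight (Nc d : ℕ) : ℝ := ((min d Nc : ℕ) : ℝ) / Nc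

theorem lagWeight_nonneg (Nc d : ℕ) : 0 ≤ lagWeight Nc d := by unfold lagWeight; positivity

theorem lagWeight_le_one (Nc d : ℕ) : lagWeight Nc d ≤ 1 := by
  unfold lagWeight
  exact div_le_one_of_le₀ (by exact_mod_cast min_le_right _ _) (Nat.cast_nonneg _)

theorem siEnergy_eq {L : ℕ} (LP Nc : ℕ) (a : Fin L → ℂ) :
    siEnergy LP Nc a = ∑ m : Fin (L - 1), lagWeight Nc (L - (m + 1)) *
      ‖∑ i, ∑ j, (meet m i j : ℂ) *
        (((finger LP j + finger LP i : ℝ) : ℂ) * (starRingEnd ℂ (a j) * a i))‖ ^ 2 := by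
  rw [siEnergy, sqNorm_eq]
  refine Finset.sum_congr rfl fun m _ => ?_
  rw [phiMatrix, Matrix.mulVec_diagonal, norm_mul, mul_pow, Complex.norm_real, Real.norm_eq_abs,
    sq_abs, Real.sq_sqrt (by positivity), Pi.add_apply, shiftMatrix_conjTranspose_mulVec,
    shiftMatrix_conjTranspose_mulVec, ← Finset.sum_add_distrib, lagWeight]
  congr 3
  refine Finset.sum_congr rfl fun i _ => ?_
  rw [← Finset.sum_add_distrib]
  refine Finset.sum_congr rfl fun j _ => ?_
  rw [rake_apply, rake_apply, map_mul, Complex.conj_ofReal]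
  push_cast
  ring

/-- The three summands of the energy are the correlations at lags of one sign, of the other sign and
at lag zero. Together they run over all lags, so no order condition between `i` and `j` survives. -/
theorem maiEnergy_eq {L : ℕ} (LP : ℕ) (b a : Fin L → ℂ) :
    ((maiEnergy LP b a : ℝ) : ℂ) = ∑ i : Fin L, ∑ i' : Fin L, ∑ j : Fin L, ∑ j' : Fin L,
      ((if (j : ℕ) + i' = j' + i then finger LP j * finger LP j' else 0 : ℝ) : ℂ) *
      ((starRingEnd ℂ (b j) * a i) * starRingEnd ℂ (starRingEnd ℂ (b j') * a i')) := by
  set z : Fin L → Fin L → ℂ := fun i j => starRingEnd ℂ (rake L LP b j) * a i with hz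
  have h1 : sqNorm ((shiftMatrix (rake L LP b))ᴴ *ᵥ a)
      = ∑ m : Fin (L - 1), 1 * ‖∑ i, ∑ j, (meet m i j : ℂ) * z i j‖ ^ 2 := by
    rw [sqNorm_eq]
    exact Finset.sum_congr rfl fun m _ => by rw [shiftMatrix_conjTranspose_mulVec, one_mul]
  have h2 : sqNorm ((shiftMatrix a)ᴴ *ᵥ rake L LP b)
      = ∑ m : Fin (L - 1), 1 * ‖∑ i, ∑ j, (meet m j i : ℂ) * z i j‖ ^ 2 := by
    rw [sqNorm_eq]
    refine Finset.sum_congr rfl fun m _ => ?_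
    rw [shiftMatrix_conjTranspose_mulVec, one_mul, ← RCLike.norm_conj, map_sum, Finset.sum_comm]
    simp only [map_sum]
    rw [Finset.sum_comm]
    congr 2
    rw [Finset.sum_comm]
    refine Finset.sum_congr rfl fun i _ => Finset.sum_congr rfl fun j _ => ?_
    rw [map_mul, map_mul, Complex.conj_ofReal, Complex.conj_conj, mul_comm (a j)]
  have h3 : ‖star (rake L LP b) ⬝ᵥ a‖ ^ 2
      = ∑ m : Unit, 1 * ‖∑ i, ∑ j, ((if i = j then 1 else 0 : ℝ) : ℂ) * z i j‖ ^ 2 := by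
    rw [Finset.univ_unique, Finset.sum_singleton, one_mul, dotProduct]
    congr 2
    refine Finset.sum_congr rfl fun i _ => ?_
    rw [Finset.sum_eq_single i (fun j _ hj => by simp [hj.symm]) (by simp)]
    simp [hz]
  rw [maiEnergy, h1, h2, h3, Complex.ofReal_add, Complex.ofReal_add, sum_mul_norm_sq,
    sum_mul_norm_sq, sum_mul_norm_sq, ← Finset.sum_add_distrib, ← Finset.sum_add_distrib]
  refine Finset.sum_congr rfl fun i _ => ?_
  rw [← Finset.sum_add_distrib, ← Finset.sum_add_distrib]
  refine Finset.sum_congr rfl fun i' _ => ?_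
  rw [← Finset.sum_add_distrib, ← Finset.sum_add_distrib]
  refine Finset.sum_congr rfl fun j _ => ?_
  rw [← Finset.sum_add_distrib, ← Finset.sum_add_distrib]
  refine Finset.sum_congr rfl fun j' _ => ?_
  rw [← add_mul, ← add_mul, ← Complex.ofReal_add, ← Complex.ofReal_add]
  have hK : ∑ m : Fin (L - 1), 1 * (meet m i j * meet m i' j')
      + ∑ m : Fin (L - 1), 1 * (meet m j i * meet m j' i')
      + ∑ m : Unit, 1 * ((if i = j then 1 else 0 : ℝ) * (if i' = j' then 1 else 0 : ℝ))
      = if (j : ℕ) + i' = j' + i then 1 else 0 := by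
    rw [sum_meet_mul_meet (fun _ => 1), sum_meet_mul_meet (fun _ => 1)]
    simp only [Finset.univ_unique, Finset.sum_singleton, one_mul, Fin.ext_iff, Fin.lt_def]
    split_ifs <;> first | omega | norm_num
  rw [hK, hz]
  simp only [rake_apply, map_mul, Complex.conj_ofReal, Complex.conj_conj]
  split_ifs
  · push_cast; ring
  · simp

end Energy

/-! ### Fluctuations of energies and powers -/

namespace Gains

variable {Ω ι : Type*} {mΩ : MeasurableSpace Ω} {P : Measure Ω} {n : ℕ} {A : ℝ}

/-- On the diagonal `i = i'` the relation forces `j = j'`, and what remains is a sum of products `‖X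
i‖²‖X j‖²` whose mean is subtracted. The off-diagonal part is an autocorrelation form plus its
conjugate. -/
theorem siEnergy_sub [IsProbabilityMeasure P] {X : Fin n → Ω → ℂ} {v : Fin n → ℝ}
    (h : Gains P X v A) (LP Nc : ℕ) :
    L4Bound P (fun ω => ((siEnergy LP Nc (fun l => X l ω) - ∑ i : Fin n, ∑ j : Fin n,
        (if i < j then lagWeight Nc ((j : ℕ) - i) * (finger LP j + finger LP i) ^ 2 else 0) *
          (v i * v j) : ℝ) : ℂ))
      (10000000 * A ^ 4 * n ^ 3) := by
  set c : Fin n → Fin n → ℝ := fun i j => finger LP j + finger LP i with hc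
  have hc0 : ∀ i j, 0 ≤ c i j := fun i j => add_nonneg (finger_nonneg _ _) (finger_nonneg _ _)
  have hc2 : ∀ i j, c i j ≤ 2 := fun i j => by
    linarith [finger_le_one LP j, finger_le_one LP i]
  set K : Fin n → Fin n → Fin n → Fin n → ℝ := fun i i' j j' =>
    (if (j : ℕ) + i' = j' + i then (if i < j then lagWeight Nc ((j : ℕ) - i) else 0) else 0) *
      (c i j * c i' j') with hK
  have hKle : ∀ i i' j j', ‖(K i i' j j' : ℂ)‖ ≤ 4 := by
    intro i i' j j'
    have h0 : 0 ≤ c i j * c i' j' := mul_nonneg (hc0 _ _) (hc0 _ _)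
    have h4 : c i j * c i' j' ≤ 4 := by nlinarith [hc0 i j, hc0 i' j', hc2 i j, hc2 i' j']
    have hw := lagWeight_nonneg Nc ((j : ℕ) - i)
    have hw1 := lagWeight_le_one Nc ((j : ℕ) - i)
    rw [Complex.norm_real, hK]
    simp only
    split_ifs
    · rw [Real.norm_of_nonneg (mul_nonneg hw h0)]; nlinarith
    · simp
    · simp
  have hKs : ∀ i i' j j', K i i' j j' ≠ 0 → i < j ∧ (j : ℕ) + i' = j' + i := by
    intro i i' j j' hne
    simp only [hK] at hne
    split_ifs at hne with h1 h2
    · exact ⟨h2, h1⟩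
    · simp at hne
    · simp at hne
  have hKsymm : ∀ i i' j j', K i' i j' j = K i i' j j' := by
    intro i i' j j'
    simp only [hK, mul_comm (c i' j')]
    congr 1
    by_cases h1 : (j : ℕ) + i' = j' + i
    · rw [if_pos h1, if_pos h1.symm]
      have : (j' : ℕ) - i' = j - i := by omega
      rw [this]
      simp only [Fin.lt_def]
      congr 1
      exact propext (by omega)
    · rw [if_neg h1, if_neg (fun h => h1 h.symm)]
  have hE : ∀ ω, ((siEnergy LP Nc (fun l => X l ω) : ℝ) : ℂ) = ∑ i, ∑ i', ∑ j, ∑ j',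
      (K i i' j j' : ℂ) * ((starRingEnd ℂ (X j ω) * X i ω) *
        starRingEnd ℂ (starRingEnd ℂ (X j' ω) * X i' ω)) := by
    intro ω
    rw [siEnergy_eq, sum_mul_norm_sq (fun m : Fin (n - 1) => lagWeight Nc (n - (m + 1)))]
    refine Finset.sum_congr rfl fun i _ => Finset.sum_congr rfl fun i' _ =>
      Finset.sum_congr rfl fun j _ => Finset.sum_congr rfl fun j' _ => ?_
    rw [sum_meet_mul_meet]
    simp only [hK, hc, map_mul, Complex.conj_ofReal]
    push_cast
    ring
  -- Dictionary: `s = j'`, `q = i'`, `p = j`, with `i` unchanged.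
  have hO := h.autocorrelation (κ := fun s q p i => if i < q then (K i q p s : ℂ) else 0) (D := 4)
    (fun s q p i => by
      split_ifs
      · exact hKle _ _ _ _
      · simp)
    (fun s q p i hne => by
      obtain ⟨h1, h2⟩ := ite_ne_right_iff.1 hne
      have h3 := hKs i q p s (by simpa using h2)
      exact ⟨h3.1, h1, h3.2⟩)
  have hD := h.diagonal (κ := fun i j => (K i i j j : ℂ)) (D := 4) (fun i j => hKle _ _ _ _)
    (fun i j hne => (hKs i i j j (by simpa using hne)).1)
  refine L4Bound.mono (B' := 10000000 * A ^ 4 * n ^ 3)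
    (B := 4 * (4 * (32 * A ^ 2 * 4 ^ 2 * n ^ 3 + 10000 * A ^ 4 * 4 ^ 2 * n ^ 3)
    + 10000 * A ^ 4 * 4 ^ 2 * n ^ 3)) ?_ (by
      have h1 : A ^ 2 ≤ A ^ 4 := pow_le_pow_right₀ h.one_le (by norm_num)
      have h2 : 0 ≤ (n : ℝ) ^ 3 := by positivity
      have h3 : 0 ≤ A ^ 4 := by have := h.nonneg; positivity
      nlinarith [mul_le_mul_of_nonneg_right h1 h2, mul_nonneg h3 h2])
  convert (hD.add hO).add hO.conj using 1
  ext ω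
  have hOeq : ∑ s, ∑ q, ∑ p, ∑ i, (if i < q then (K i q p s : ℂ) else 0) *
      (X s ω * starRingEnd ℂ (X q ω) * starRingEnd ℂ (X p ω) * X i ω)
      = ∑ i, ∑ i', (if i < i' then ∑ j, ∑ j', (K i i' j j' : ℂ) * ((starRingEnd ℂ (X j ω) * X i ω) *
        starRingEnd ℂ (starRingEnd ℂ (X j' ω) * X i' ω)) else 0) := by
    rw [sum_comm₄]
    refine Finset.sum_congr rfl fun i _ => Finset.sum_congr rfl fun i' _ => ?_
    split_ifs
    · refine Finset.sum_congr rfl fun j _ => Finset.sum_congr rfl fun j' _ => ?_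
      rw [map_mul, Complex.conj_conj]; ring
    · simp
  rw [Complex.ofReal_sub, hE, sum_hermitian _ (fun i i' => ?_), hOeq]
  · rw [add_sub_right_comm, add_sub_right_comm]
    congr 2
    rw [Complex.ofReal_sum, ← Finset.sum_sub_distrib]
    refine Finset.sum_congr rfl fun i _ => ?_
    rw [Complex.ofReal_sum, ← Finset.sum_sub_distrib]
    refine Finset.sum_congr rfl fun j _ => ?_
    rw [Finset.sum_eq_single j (fun j' _ hj' => ?_) (by simp), mul_sub]
    · congr 1
      · rw [map_mul, Complex.conj_conj, ← Complex.normSq_eq_norm_sq, ← Complex.normSq_eq_norm_sq,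
          Complex.normSq_eq_conj_mul_self, Complex.normSq_eq_conj_mul_self]
        ring
      · simp only [hK, if_true, hc]
        split_ifs <;> push_cast <;> ring
    · have : K i i j j' = 0 := by
        by_contra hne
        exact hj' (by have := (hKs i i j j' hne).2; ext; omega)
      rw [this]; simp
  · simp only [map_sum]
    rw [Finset.sum_comm]
    refine Finset.sum_congr rfl fun j _ => Finset.sum_congr rfl fun j' _ => ?_
    rw [hKsymm]
    simp only [map_mul, Complex.conj_conj, Complex.conj_ofReal]
    ring

/-- Here the diagonal part is exactly the product of the two random powers, so no mean has to be
subtracted. The family `f` belongs to the receiving user and `e` to the interferer. -/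
theorem maiEnergy_sub [IsProbabilityMeasure P] {X : ι → Ω → ℂ} {v : ι → ℝ} {e f : Fin n → ι}
    (h : Gains P X v A) (he : Function.Injective e) (hf : Function.Injective f)
    (hef : ∀ i j, e i ≠ f j) (LP : ℕ) :
    L4Bound P (fun ω => ((maiEnergy LP (fun l => X (f l) ω) (fun l => X (e l) ω)
        - (∑ j : Fin n, finger LP j * ‖X (f j) ω‖ ^ 2) * ∑ i, ‖X (e i) ω‖ ^ 2 : ℝ) : ℂ))
      (10000000 * A ^ 4 * n ^ 3) := by
  set K : Fin n → Fin n → Fin n → Fin n → ℝ := fun i i' j j' =>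
    (if (j : ℕ) + i' = j' + i then finger LP j * finger LP j' else 0) with hK
  have hKle : ∀ i i' j j', ‖(K i i' j j' : ℂ)‖ ≤ 1 := by
    intro i i' j j'
    have h1 := finger_nonneg LP j
    have h2 := finger_nonneg LP j'
    rw [Complex.norm_real, hK]
    simp only
    split_ifs
    · rw [Real.norm_of_nonneg (mul_nonneg h1 h2)]
      exact mul_le_one₀ (finger_le_one _ _) h2 (finger_le_one _ _)
    · simp
  have hKs : ∀ i i' j j', K i i' j j' ≠ 0 → (j : ℕ) + i' = j' + i := by
    intro i i' j j' hne
    exact (ite_ne_right_iff.1 hne).1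
  have hKsymm : ∀ i i' j j', K i' i j' j = K i i' j j' := by
    intro i i' j j'
    simp only [hK, mul_comm (finger LP j'), eq_comm (a := (j' : ℕ) + i)]
  -- Dictionary: `s = i'`, `q = i`, `p = j'`, and the bound index `i` is `j`.
  have hO := h.crosscorrelation he hf hef
    (κ := fun s q p i => if q < s then (K q s i p : ℂ) else 0) (D := 1)
    (fun s q p i => by
      split_ifs
      · exact hKle _ _ _ _
      · simp)
    (fun s q p i hne => by
      obtain ⟨h1, h2⟩ := ite_ne_right_iff.1 hne
      have h3 := hKs q s i p (by simpa using h2)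
      refine ⟨h1, ?_, h3⟩
      simp only [Fin.lt_def] at *; omega)
  refine L4Bound.mono (B' := 10000000 * A ^ 4 * n ^ 3)
    (B := 4 * (256 * A ^ 4 * 1 ^ 2 * n ^ 3 + 256 * A ^ 4 * 1 ^ 2 * n ^ 3)) ?_ (by
      have : 0 ≤ A ^ 4 * (n : ℝ) ^ 3 := by have := h.nonneg; positivity
      nlinarith)
  convert hO.add hO.conj using 1
  ext ω
  have hOeq : ∑ s, ∑ q, ∑ p, ∑ i, (if q < s then (K q s i p : ℂ) else 0) *
      (starRingEnd ℂ (X (e s) ω) * X (e q) ω * X (f p) ω * starRingEnd ℂ (X (f i) ω))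
      = ∑ i, ∑ i', (if i < i' then ∑ j, ∑ j', (K i i' j j' : ℂ) *
        ((starRingEnd ℂ (X (f j) ω) * X (e i) ω) *
        starRingEnd ℂ (starRingEnd ℂ (X (f j') ω) * X (e i') ω)) else 0) := by
    rw [Finset.sum_comm]
    refine Finset.sum_congr rfl fun i _ => Finset.sum_congr rfl fun i' _ => ?_
    rw [Finset.sum_comm]
    split_ifs
    · refine Finset.sum_congr rfl fun j _ => Finset.sum_congr rfl fun j' _ => ?_
      rw [map_mul, Complex.conj_conj]; ring
    · simp
  rw [Complex.ofReal_sub, maiEnergy_eq, sum_hermitian _ (fun i i' => ?_), hOeq]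
  · rw [add_sub_right_comm, add_sub_right_comm, add_assoc]
    refine add_eq_right.2 ?_
    rw [sub_eq_zero, mul_comm, Finset.sum_mul_sum, Complex.ofReal_sum]
    refine Finset.sum_congr rfl fun i _ => ?_
    rw [Complex.ofReal_sum]
    refine Finset.sum_congr rfl fun j _ => ?_
    rw [Finset.sum_eq_single j (fun j' _ hj' => ?_) (by simp)]
    · have hfin : finger LP j * finger LP j = finger LP j := by
        unfold finger; split_ifs <;> norm_num
      rw [if_pos rfl, hfin, map_mul, Complex.conj_conj, ← Complex.normSq_eq_norm_sq,
        ← Complex.normSq_eq_norm_sq, Complex.ofReal_mul, Complex.ofReal_mul,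
        Complex.normSq_eq_conj_mul_self, Complex.normSq_eq_conj_mul_self]
      ring
    · rw [if_neg (fun hh => hj' (by ext; omega))]; simp
  · simp only [map_sum]
    rw [Finset.sum_comm]
    refine Finset.sum_congr rfl fun j _ => Finset.sum_congr rfl fun j' _ => ?_
    have := hKsymm i i' j j'
    simp only [hK] at this
    rw [this]
    simp only [map_mul, Complex.conj_conj, Complex.conj_ofReal]
    ring

/-- Fluctuation of a received power. -/
theorem power_sub [IsProbabilityMeasure P] {X : Fin n → Ω → ℂ} {v : Fin n → ℝ}
    (h : Gains P X v A) {c : Fin n → ℝ} (hc : ∀ i, ‖c i‖ ≤ 1) :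
    L4Bound P (fun ω => ((∑ i, c i * ‖X i ω‖ ^ 2 - ∑ i, c i * v i : ℝ) : ℂ)) (4 * A * n) := by
  have := h.sum_sub_var (Z := fun i _ => (c i : ℂ)) (B := 1) (fun i => measurable_const)
    (fun i => (L4Bound.const _).mono (by
      rw [Complex.norm_real]; exact pow_le_one₀ (norm_nonneg _) (hc i)))
  rw [mul_one] at this
  convert this using 1
  ext ω
  rw [← Finset.sum_sub_distrib, Complex.ofReal_sum]
  refine Finset.sum_congr rfl fun i _ => ?_
  push_cast
  ring

end Gains

/-! ### From fourth moments to almost sure convergence -/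

section AlmostSure

variable {Ω : Type*} {mΩ : MeasurableSpace Ω} {P : Measure Ω}

/-- The normalised fourth moments are at most `C² / L²`, hence summable. By monotone convergence the
series of fourth powers is almost surely finite, so its terms vanish; no relation between different
`n` is needed. -/
theorem ae_tendsto_zero_of_l4Bound {f : ℕ → Ω → ℂ} {B : ℕ → ℝ} (h : ∀ n, L4Bound P (f n) (B n))
    {L : ℕ → ℕ} (hL : StrictMono L) (hpos : ∀ n, 0 < L n) {r : ℕ} {C : ℝ}
    (hB : ∀ n, B n * L n ≤ C * ((L n : ℝ) ^ r) ^ 2) :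
    ∀ᵐ ω ∂P, Tendsto (fun n => f n ω / (L n : ℂ) ^ r) atTop (𝓝 0) := by
  set g : ℕ → Ω → ℝ := fun n ω => ‖f n ω‖ ^ 4 / ((L n : ℝ) ^ r) ^ 4 with hg
  have hg0 : ∀ n ω, 0 ≤ g n ω := fun n ω => by positivity
  have hgi : ∀ n, Integrable (g n) P := fun n => (h n).int.div_const _
  have hgle : ∀ n, ∫ ω, g n ω ∂P ≤ C ^ 2 * (1 / (L n : ℝ) ^ 2) := by
    intro n
    have hLn : (0 : ℝ) < L n := by exact_mod_cast hpos n
    rw [hg]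
    simp only
    rw [integral_div, mul_one_div, div_le_div_iff₀ (by positivity) (by positivity)]
    calc (∫ ω, ‖f n ω‖ ^ 4 ∂P) * (L n : ℝ) ^ 2 ≤ B n ^ 2 * (L n : ℝ) ^ 2 :=
          mul_le_mul_of_nonneg_right (h n).le (by positivity)
      _ = (B n * L n) ^ 2 := by ring
      _ ≤ (C * ((L n : ℝ) ^ r) ^ 2) ^ 2 :=
          pow_le_pow_left₀ (mul_nonneg (h n).nonneg hLn.le) (hB n) 2
      _ = _ := by ring
  have hs : Summable fun n => ∫ ω, g n ω ∂P := by
    refine Summable.of_nonneg_of_le (fun n => integral_nonneg (hg0 n)) hgle ?_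
    -- Distinct values of `L n` turn the series into a subseries of `∑ 1 / m ^ 2`.
    exact ((Real.summable_one_div_nat_pow.2 one_lt_two).comp_injective hL.injective).mul_left _
  have hgm : ∀ n, AEMeasurable (fun ω => ENNReal.ofReal (g n ω)) P := fun n =>
    (hgi n).aemeasurable.ennreal_ofReal
  have hfin : ∫⁻ ω, ∑' n, ENNReal.ofReal (g n ω) ∂P ≠ ⊤ := by
    rw [lintegral_tsum hgm]
    have : ∀ n, ∫⁻ ω, ENNReal.ofReal (g n ω) ∂P = ENNReal.ofReal (∫ ω, g n ω ∂P) := fun n =>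
      (ofReal_integral_eq_lintegral_ofReal (hgi n) (ae_of_all _ (hg0 n))).symm
    simp only [this]
    rw [← ENNReal.ofReal_tsum_of_nonneg (fun n => integral_nonneg (hg0 n)) hs]
    exact ENNReal.ofReal_ne_top
  filter_upwards [ae_lt_top' (AEMeasurable.tsum hgm) hfin] with ω hω
  have h0 := ENNReal.tendsto_atTop_zero_of_tsum_ne_top hω.ne
  have h1 : Tendsto (fun n => g n ω) atTop (𝓝 0) := by
    have := (ENNReal.tendsto_toReal ENNReal.zero_ne_top).comp h0
    simpa [Function.comp_def, ENNReal.toReal_ofReal (hg0 _ ω)] using this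
  -- The fourth root is taken as two square roots.
  have h2 := ((Real.continuous_sqrt.comp Real.continuous_sqrt).tendsto 0).comp h1
  rw [tendsto_zero_iff_norm_tendsto_zero]
  simp only [Function.comp_def, Real.sqrt_zero] at h2
  refine h2.congr fun n => ?_
  have : g n ω = ((‖f n ω / (L n : ℂ) ^ r‖) ^ 2) ^ 2 := by
    simp only [hg, norm_div, norm_pow, Complex.norm_natCast]
    ring
  rw [this, Real.sqrt_sq (by positivity), Real.sqrt_sq (by positivity)]

end AlmostSure

/-! ### Moments of circular Gaussians -/

section Gaussian

theorem measurable_mk_complex : Measurable (fun p : ℝ × ℝ => (⟨p.1, p.2⟩ : ℂ)) :=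
  Complex.measurableEquivRealProd.symm.measurable

instance (v : ℝ) : IsProbabilityMeasure (circGaussian v) :=
  Measure.isProbabilityMeasure_map measurable_mk_complex.aemeasurable

/-- Scaling reduces every moment estimate to unit variance, which makes the bounds uniform over
paths and systems. -/
theorem circGaussian_eq_map {v : ℝ} (hv : 0 ≤ v) :
    circGaussian v = (circGaussian 1).map (fun z => (Real.sqrt v : ℂ) * z) := by
  have h : gaussianReal 0 (v / 2).toNNReal
      = (gaussianReal 0 ((1 : ℝ) / 2).toNNReal).map (Real.sqrt v * ·) := by
    rw [gaussianReal_map_const_mul, mul_zero]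
    congr 1
    ext
    push_cast
    rw [Real.coe_toNNReal _ (by positivity), Real.coe_toNNReal _ (by positivity),
      Real.sq_sqrt hv]
    ring
  have hm : Measurable (Real.sqrt v * ·) := measurable_const_mul _
  rw [circGaussian, h, Measure.map_prod_map _ _ hm hm, circGaussian,
    Measure.map_map measurable_mk_complex (hm.prodMap hm),
    Measure.map_map (measurable_const_mul _) measurable_mk_complex]
  congr 1
  ext p
  apply Complex.ext <;> simp

theorem integrable_norm_pow_circGaussian :
    Integrable (fun z : ℂ => ‖z‖ ^ 8) (circGaussian 1) := by
  rw [circGaussian, integrable_map_measure (by fun_prop) measurable_mk_complex.aemeasurable]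
  have h : Integrable (fun x : ℝ => x ^ 8) (gaussianReal 0 ((1 : ℝ) / 2).toNNReal) := by
    have := (memLp_id_gaussianReal (μ := 0) (v := ((1 : ℝ) / 2).toNNReal) 8).integrable_norm_pow
      (by norm_num)
    refine this.congr (ae_of_all _ fun x => ?_)
    simp only [id, Real.norm_eq_abs]
    exact Even.pow_abs (by decide) x
  refine (((h.comp_fst _).add (h.comp_snd _)).const_mul 8).mono'
    ((by fun_prop : Measurable fun z : ℂ => ‖z‖ ^ 8).comp
      measurable_mk_complex).aestronglyMeasurable (ae_of_all _ fun p => ?_)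
  have e : ‖(⟨p.1, p.2⟩ : ℂ)‖ ^ 8 = (p.1 ^ 2 + p.2 ^ 2) ^ 4 := by
    have : ‖(⟨p.1, p.2⟩ : ℂ)‖ ^ 2 = p.1 ^ 2 + p.2 ^ 2 := by
      rw [← Complex.normSq_eq_norm_sq, Complex.normSq_apply]; ring
    rw [← this]; ring
  simp only [Function.comp, Pi.add_apply]
  rw [Real.norm_of_nonneg (by positivity), e]
  have := add_pow_le (sq_nonneg p.1) (sq_nonneg p.2) 4
  norm_num at this
  linarith [this]

theorem integral_circGaussian : ∫ z, z ∂(circGaussian 1) = 0 := by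
  rw [circGaussian, integral_map measurable_mk_complex.aemeasurable (by fun_prop)]
  have h : Integrable (fun x : ℝ => (x : ℂ)) (gaussianReal 0 ((1 : ℝ) / 2).toNNReal) :=
    ((memLp_id_gaussianReal (μ := 0) (v := ((1 : ℝ) / 2).toNNReal) 1).integrable le_rfl).ofReal
  have h0 : ∫ x : ℝ, (x : ℂ) ∂(gaussianReal 0 ((1 : ℝ) / 2).toNNReal) = 0 := by
    rw [integral_complex_ofReal, integral_id_gaussianReal, Complex.ofReal_zero]
  have e : ∀ p : ℝ × ℝ, (⟨p.1, p.2⟩ : ℂ) = (p.1 : ℂ) + (p.2 : ℂ) * Complex.I := fun p => by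
    apply Complex.ext <;> simp
  simp only [e]
  rw [integral_add (h.comp_fst _) ((h.comp_snd _).mul_const _),
    integral_fun_fst (fun x : ℝ => (x : ℂ)), integral_mul_const,
    integral_fun_snd (fun x : ℝ => (x : ℂ)), h0]
  simp

theorem integral_norm_sq_circGaussian : ∫ z, ‖z‖ ^ 2 ∂(circGaussian 1) = 1 := by
  rw [circGaussian, integral_map measurable_mk_complex.aemeasurable (by fun_prop)]
  have h : Integrable (fun x : ℝ => x ^ 2) (gaussianReal 0 ((1 : ℝ) / 2).toNNReal) :=
    (memLp_id_gaussianReal (μ := 0) (v := ((1 : ℝ) / 2).toNNReal) 2).integrable_sq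
  have h0 : ∫ x : ℝ, x ^ 2 ∂(gaussianReal 0 ((1 : ℝ) / 2).toNNReal) = 1 / 2 := by
    have h1 := variance_fun_id_gaussianReal (μ := 0) (v := ((1 : ℝ) / 2).toNNReal)
    rw [variance_of_integral_eq_zero (by fun_prop) integral_id_gaussianReal,
      Real.coe_toNNReal _ (by norm_num)] at h1
    exact h1
  have e : ∀ p : ℝ × ℝ, ‖(⟨p.1, p.2⟩ : ℂ)‖ ^ 2 = p.1 ^ 2 + p.2 ^ 2 := fun p => by
    rw [← Complex.normSq_eq_norm_sq, Complex.normSq_apply]; ring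
  simp only [e]
  rw [integral_add (h.comp_fst _) (h.comp_snd _),
    integral_fun_fst (fun x : ℝ => x ^ 2), integral_fun_snd (fun x : ℝ => x ^ 2), h0]
  norm_num

/-- A bound for the moments that enter `Gains`, for a circular Gaussian of variance `1`. -/
def momentBound : ℝ := 16 * (1 + ∫ z, ‖z‖ ^ 8 ∂(circGaussian 1))

theorem one_le_momentBound : 1 ≤ momentBound := by
  have : 0 ≤ ∫ z, ‖z‖ ^ 8 ∂(circGaussian 1) := integral_nonneg fun z => by positivity
  rw [momentBound]; linarith

theorem l4Bound_circGaussian_of_le {φ : ℂ → ℂ} (hφ : Measurable φ)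
    (h : ∀ z, ‖φ z‖ ^ 4 ≤ 16 * (1 + ‖z‖ ^ 8)) : L4Bound (circGaussian 1) φ momentBound := by
  have hi : Integrable (fun z : ℂ => 16 * (1 + ‖z‖ ^ 8)) (circGaussian 1) :=
    ((integrable_const _).add integrable_norm_pow_circGaussian).const_mul _
  have hj : Integrable (fun z : ℂ => ‖φ z‖ ^ 4) (circGaussian 1) :=
    hi.mono' (hφ.norm.pow_const 4).aestronglyMeasurable (ae_of_all _ fun z => by
      rw [Real.norm_of_nonneg (by positivity)]; exact h z)
  have h1 := one_le_momentBound
  refine ⟨hφ, by linarith, hj, (integral_mono hj hi h).trans ?_⟩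
  rw [integral_const_mul, integral_add (integrable_const _) integrable_norm_pow_circGaussian]
  simp only [integral_const, probReal_univ, smul_eq_mul, one_mul]
  -- The integral is at most `momentBound`; as this is at least `1`, it is below its square, the
  -- form that `L4Bound` asks for.
  change momentBound ≤ momentBound ^ 2
  nlinarith

theorem L4Bound.of_hasLaw {Ω : Type*} {mΩ : MeasurableSpace Ω} {P : Measure Ω} {X : Ω → ℂ}
    {ν : Measure ℂ} (hX : Measurable X) (hlaw : HasLaw X ν P) {φ : ℂ → ℂ} {B : ℝ}
    (h : L4Bound ν φ B) : L4Bound P (fun ω => φ (X ω)) B := by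
  have hm : AEStronglyMeasurable (fun z => ‖φ z‖ ^ 4) (P.map X) :=
    (h.meas.norm.pow_const 4).aestronglyMeasurable
  refine ⟨h.meas.comp hX, h.nonneg, ?_, ?_⟩
  · have := h.int
    rw [← hlaw.map_eq, integrable_map_measure hm hX.aemeasurable] at this
    exact this
  · rw [← integral_map hX.aemeasurable hm, hlaw.map_eq]
    exact h.le

theorem l4Bound_circGaussian {v : ℝ} (hv : 0 ≤ v) {φ : ℂ → ℂ} (hφ : Measurable φ) {B : ℝ}
    (h : L4Bound (circGaussian 1) (fun z => φ ((Real.sqrt v : ℂ) * z)) B) :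
    L4Bound (circGaussian v) φ B := by
  have hs : Measurable (fun z : ℂ => (Real.sqrt v : ℂ) * z) := measurable_const_mul _
  have hm : Measurable (fun z => ‖φ z‖ ^ 4) := hφ.norm.pow_const 4
  rw [circGaussian_eq_map hv]
  refine ⟨hφ, h.nonneg, ?_, ?_⟩
  · rw [integrable_map_measure hm.aestronglyMeasurable hs.aemeasurable]
    exact h.int
  · rw [integral_map hs.aemeasurable hm.aestronglyMeasurable]
    exact h.le

theorem norm_sqrt_mul_sq {v : ℝ} (hv : 0 ≤ v) (z : ℂ) :
    ‖(Real.sqrt v : ℂ) * z‖ ^ 2 = v * ‖z‖ ^ 2 := by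
  rw [norm_mul, mul_pow, Complex.norm_real, Real.norm_eq_abs, sq_abs, Real.sq_sqrt hv]

/-- The constant depends only on the bound `V` for the variances, so one `A` serves the whole
sequence of systems. -/
theorem gains_of_hasLaw {Ω ι : Type*} {mΩ : MeasurableSpace Ω} {P : Measure Ω}
    [IsProbabilityMeasure P] {X : ι → Ω → ℂ} (hX : ∀ i, Measurable (X i)) (hind : iIndepFun X P)
    {v : ι → ℝ} {V : ℝ} (hv : ∀ i, 0 ≤ v i) (hV : ∀ i, v i ≤ V)
    (hlaw : ∀ i, HasLaw (X i) (circGaussian (v i)) P) :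
    Gains P X v ((1 + V ^ 2) * momentBound) := by
  have hc := one_le_momentBound
  have hc0 : 0 ≤ momentBound := by linarith
  have hV2 : ∀ i, v i ^ 2 ≤ 1 + V ^ 2 := fun i => by
    have := pow_le_pow_left₀ (hv i) (hV i) 2; linarith
  have hV1 : ∀ i, v i ≤ 1 + V ^ 2 := fun i => by nlinarith [sq_nonneg (V - 1), hV i]
  have hsq : Measurable fun z : ℂ => ((‖z‖ ^ 2 : ℝ) : ℂ) := by fun_prop
  have h1 : L4Bound (circGaussian 1) (fun z => z) momentBound :=
    l4Bound_circGaussian_of_le measurable_id fun z => by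
      nlinarith [sq_nonneg (‖z‖ ^ 4 - 1), sq_nonneg (‖z‖ ^ 4)]
  have h2 : L4Bound (circGaussian 1) (fun z => ((‖z‖ ^ 2 : ℝ) : ℂ)) momentBound :=
    l4Bound_circGaussian_of_le hsq fun z => by
      rw [Complex.norm_real, norm_pow, norm_norm]
      nlinarith [sq_nonneg (‖z‖ ^ 4)]
  have h3 : L4Bound (circGaussian 1) (fun z => ((‖z‖ ^ 2 : ℝ) : ℂ) - 1) momentBound :=
    l4Bound_circGaussian_of_le (hsq.sub_const _) fun z => by
      have : ‖((‖z‖ ^ 2 : ℝ) : ℂ) - 1‖ ≤ ‖z‖ ^ 2 + 1 := by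
        refine (norm_sub_le _ _).trans ?_
        rw [Complex.norm_real, norm_pow, norm_norm, norm_one]
      have h4 := pow_le_pow_left₀ (norm_nonneg _) this 4
      have h5 := add_pow_le (sq_nonneg ‖z‖) zero_le_one 4
      norm_num at h5
      nlinarith [sq_nonneg (‖z‖ ^ 4)]
  have hint : ∀ i, ∫ z, z ∂(circGaussian (v i)) = 0 := fun i => by
    rw [circGaussian_eq_map (hv i), integral_map (by fun_prop) (by fun_prop), integral_const_mul,
      integral_circGaussian, mul_zero]
  refine ⟨hX, hind, by nlinarith [sq_nonneg V], fun i => ?_, fun i => ?_, fun i => ?_,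
    fun i => ?_, fun i => ?_, fun i => ?_⟩
  · rw [(hlaw i).integral_eq, hint]
  · refine (L4Bound.of_hasLaw (hX i) (hlaw i)
      (l4Bound_circGaussian (hv i) measurable_id (h1.const_mul _))).mono ?_
    rw [Complex.norm_real, Real.norm_eq_abs, sq_abs, Real.sq_sqrt (hv i)]
    exact mul_le_mul_of_nonneg_right (hV1 i) hc0
  · refine (L4Bound.of_hasLaw (hX i) (hlaw i) (l4Bound_circGaussian (hv i) hsq
      (B := ‖(v i : ℂ)‖ ^ 2 * momentBound) ?_)).mono ?_
    · convert h2.const_mul (v i : ℂ) using 1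
      ext z
      rw [norm_sqrt_mul_sq (hv i), Complex.ofReal_mul]
    · rw [Complex.norm_real, Real.norm_eq_abs, sq_abs]
      exact mul_le_mul_of_nonneg_right (hV2 i) hc0
  · refine ((hlaw i).integral_comp (f := fun z : ℂ => ((‖z‖ ^ 2 : ℝ) : ℂ) - (v i : ℂ))
      (by fun_prop)).trans ?_
    rw [circGaussian_eq_map (hv i), integral_map (by fun_prop) (by fun_prop)]
    simp only [norm_sqrt_mul_sq (hv i)]
    have hi : Integrable (fun z : ℂ => v i * ‖z‖ ^ 2) (circGaussian 1) := by
      refine (((integrable_const (1 : ℝ)).add integrable_norm_pow_circGaussian).mono'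
        (by fun_prop) (ae_of_all _ fun z => ?_)).const_mul _
      rw [Real.norm_of_nonneg (by positivity)]
      simp only [Pi.add_apply]
      nlinarith [sq_nonneg (‖z‖ ^ 4 - 1), sq_nonneg (‖z‖ ^ 2 - 1)]
    rw [integral_sub hi.ofReal (integrable_const _), integral_complex_ofReal, integral_const_mul,
      integral_norm_sq_circGaussian]
    simp
  · refine (L4Bound.of_hasLaw (hX i) (hlaw i) (l4Bound_circGaussian (hv i)
      (φ := fun z => ((‖z‖ ^ 2 : ℝ) : ℂ) - (v i : ℂ)) (hsq.sub_const _)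
      (B := ‖(v i : ℂ)‖ ^ 2 * momentBound) ?_)).mono ?_
    · convert h3.const_mul (v i : ℂ) using 1
      ext z
      rw [norm_sqrt_mul_sq (hv i), Complex.ofReal_mul]
      ring
    · rw [Complex.norm_real, Real.norm_eq_abs, sq_abs]
      exact mul_le_mul_of_nonneg_right (hV2 i) hc0
  · rw [Real.norm_eq_abs, sq_abs]
    nlinarith [hV2 i, sq_nonneg V]

end Gaussian

/-! ### Riemann sums for the means -/

section Riemann

theorem integral_floor_piece (f : ℕ → ℝ) {L : ℝ} (hL : 0 < L) (i : ℕ) :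
    ∫ x in ((i : ℝ) / L)..(((i + 1 : ℕ) : ℝ) / L), f ⌊L * x⌋₊ = f i / L := by
  have hle : (i : ℝ) / L ≤ ((i + 1 : ℕ) : ℝ) / L := by gcongr; simp
  rw [intervalIntegral.integral_of_le hle, integral_Ioc_eq_integral_Ioo,
    setIntegral_congr_fun (g := fun _ => f i) measurableSet_Ioo, setIntegral_const,
    Real.volume_real_Ioo_of_le hle]
  · push_cast; rw [smul_eq_mul]; field_simp; ring
  · intro x hx
    have h1 := (div_lt_iff₀ hL).1 hx.1
    have h2 := (lt_div_iff₀ hL).1 hx.2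
    push_cast at h2
    have : ⌊L * x⌋₊ = i := by
      rw [Nat.floor_eq_iff (le_trans (Nat.cast_nonneg i) (by linarith))]
      constructor <;> linarith
    simp only [this]

theorem sum_range_eq_integral (f : ℕ → ℝ) {L : ℕ} (hL : 0 < L) (R : ℕ) {A : ℕ} (hA : A ≤ R * L) :
    (∑ i ∈ Finset.range A, f i) / L
      = ∫ x in (0 : ℝ)..R, (if ⌊(L : ℝ) * x⌋₊ < A then f ⌊(L : ℝ) * x⌋₊ else 0) := by
  have hL' : (0 : ℝ) < L := by exact_mod_cast hL
  set F : ℕ → ℝ := fun i => if i < A then f i else 0 with hF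
  have hint : ∀ k < R * L, IntervalIntegrable (fun x : ℝ => F ⌊(L : ℝ) * x⌋₊) volume
      ((k : ℝ) / L) (((k + 1 : ℕ) : ℝ) / L) := by
    intro k _
    have hm : Measurable (fun x : ℝ => F ⌊(L : ℝ) * x⌋₊) :=
      (measurable_from_nat (f := F)).comp (Nat.measurable_floor.comp (measurable_const_mul _))
    refine (intervalIntegrable_const (c := ∑ i ∈ Finset.range A, |f i|)).mono_fun
      hm.aestronglyMeasurable (ae_of_all _ fun x => ?_)
    refine le_trans ?_ (le_abs_self _)
    simp only [hF, Real.norm_eq_abs]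
    split_ifs with h
    · exact Finset.single_le_sum (f := fun i => |f i|) (fun _ _ => abs_nonneg _)
        (Finset.mem_range.2 h)
    · simpa using Finset.sum_nonneg fun i _ => abs_nonneg (f i)
  have h := intervalIntegral.sum_integral_adjacent_intervals (a := fun k : ℕ => (k : ℝ) / L) hint
  simp only [integral_floor_piece F hL'] at h
  have e : ((R * L : ℕ) : ℝ) / L = R := by push_cast; field_simp
  rw [e] at h
  simp only [Nat.cast_zero, zero_div] at h
  rw [← h, ← Finset.sum_div, hF]
  congr 1
  rw [← Finset.sum_filter]
  refine Finset.sum_congr ?_ fun _ _ => rfl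
  ext i
  simp only [Finset.mem_range, Finset.mem_filter]
  omega

/-- A sum over `i < A n` divided by `L n` is the integral of a step function of `⌊L n * x⌋₊`, to
which dominated convergence applies. -/
theorem tendsto_sum_div {L A : ℕ → ℕ} (hL0 : ∀ n, 0 < L n) {a : ℝ}
    (hA : Tendsto (fun n => (A n : ℝ) / L n) atTop (𝓝 a)) {f : ℕ → ℕ → ℝ}
    {g : ℝ → ℝ} {C : ℝ} (hC : 0 ≤ C) (hf : ∀ n i, i < A n → |f n i| ≤ C)
    (hlim : ∀ x, 0 < x → x < a → Tendsto (fun n => f n ⌊(L n : ℝ) * x⌋₊) atTop (𝓝 (g x))) :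
    Tendsto (fun n => (∑ i ∈ Finset.range (A n), f n i) / L n) atTop (𝓝 (∫ x in 0..a, g x)) := by
  have ha : 0 ≤ a := ge_of_tendsto' hA fun n => by positivity
  -- `A n / L n` may exceed `a`, so the integrals are taken over a fixed larger interval `[0, R]`,
  -- with a cut-off in the integrand.
  obtain ⟨R, hR⟩ := exists_nat_gt a
  have hLR : ∀ n, (0 : ℝ) < L n := fun n => by exact_mod_cast hL0 n
  have hev : ∀ᶠ n in atTop, A n ≤ R * L n := by
    filter_upwards [hA.eventually_lt_const hR] with n hn
    have := (div_lt_iff₀ (hLR n)).1 hn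
    exact_mod_cast this.le
  have hlimit : ∫ x in (0 : ℝ)..R, (if x < a then g x else 0) = ∫ x in 0..a, g x := by
    rw [intervalIntegral.integral_of_le (Nat.cast_nonneg R), intervalIntegral.integral_of_le ha,
      integral_Ioc_eq_integral_Ioo (x := 0) (y := a)]
    have : (fun x => if x < a then g x else 0) = (Set.Iio a).indicator g := by
      ext x; simp [Set.indicator_apply]
    rw [this, setIntegral_indicator measurableSet_Iio]
    congr 2
    ext x
    simp only [Set.mem_inter_iff, Set.mem_Ioc, Set.mem_Iio, Set.mem_Ioo]
    constructor
    · rintro ⟨⟨h1, -⟩, h2⟩; exact ⟨h1, h2⟩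
    · rintro ⟨h1, h2⟩; exact ⟨⟨h1, by linarith⟩, h2⟩
  rw [← hlimit]
  refine Tendsto.congr' (f₁ := fun n => ∫ x in (0 : ℝ)..R,
    (if ⌊(L n : ℝ) * x⌋₊ < A n then f n ⌊(L n : ℝ) * x⌋₊ else 0)) ?_ ?_
  · filter_upwards [hev] with n hn
    exact (sum_range_eq_integral (f n) (hL0 n) R hn).symm
  refine intervalIntegral.tendsto_integral_filter_of_dominated_convergence (fun _ => C) ?_ ?_
    intervalIntegrable_const ?_
  · refine Eventually.of_forall fun n => Measurable.aestronglyMeasurable ?_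
    exact (measurable_from_nat (f := fun i => if i < A n then f n i else 0)).comp
      (Nat.measurable_floor.comp (measurable_const_mul _))
  · refine Eventually.of_forall fun n => ae_of_all _ fun x _ => ?_
    rw [Real.norm_eq_abs]
    split_ifs with h
    · exact hf n _ h
    · simpa using hC
  · have hne : ∀ᵐ x : ℝ ∂volume, x ≠ a := by simp [ae_iff, measure_singleton]
    filter_upwards [hne] with x hxa hx
    rw [Set.uIoc_of_le (Nat.cast_nonneg R)] at hx
    rcases lt_or_gt_of_ne hxa with h | h
    · rw [if_pos h]
      refine (hlim x hx.1 h).congr' ?_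
      filter_upwards [hA.eventually_const_lt h] with n hn
      rw [if_pos]
      rw [Nat.floor_lt (mul_nonneg (hLR n).le hx.1.le)]
      have := (lt_div_iff₀ (hLR n)).1 hn
      linarith
    · rw [if_neg h.not_gt]
      refine tendsto_const_nhds.congr' ?_
      filter_upwards [hA.eventually_lt_const h] with n hn
      rw [if_neg]
      rw [Nat.floor_lt (mul_nonneg (hLR n).le hx.1.le)]
      have := (div_lt_iff₀ (hLR n)).1 hn
      linarith

/-- The exponentially decaying profile, normalised to `1` on the first path. -/
def profile (Ψ : ℝ) (L i : ℕ) : ℝ := Ψ ^ (-((i : ℝ) / ((L : ℝ) - 1)))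

theorem profile_pos {Ψ : ℝ} (hΨ : 0 < Ψ) (L i : ℕ) : 0 < profile Ψ L i := Real.rpow_pos_of_pos hΨ _

/-- The profile is geometric: shifting both indices of a pair only rescales its weight. -/
theorem profile_add {Ψ : ℝ} (hΨ : 0 < Ψ) (L i j : ℕ) :
    profile Ψ L (i + j) = profile Ψ L i * profile Ψ L j := by
  rw [profile, profile, profile, ← Real.rpow_add hΨ]
  congr 1
  push_cast
  ring

theorem profile_le {Ψ : ℝ} (hΨ : 0 < Ψ) {L i : ℕ} (hi : i < L) :
    profile Ψ L i ≤ 1 + Ψ⁻¹ := by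
  have h1 : (0 : ℝ) ≤ (L : ℝ) - 1 := by
    have : 1 ≤ L := by omega
    have : (1 : ℝ) ≤ L := by exact_mod_cast this
    linarith
  -- The exponent lies in `[-1, 0]`, also for `L = 1`, where the quotient is `0 / 0 = 0`.
  have ht0 : 0 ≤ (i : ℝ) / ((L : ℝ) - 1) := by positivity
  have ht1 : (i : ℝ) / ((L : ℝ) - 1) ≤ 1 := by
    refine div_le_one_of_le₀ ?_ h1
    have : i + 1 ≤ L := hi
    have : ((i : ℝ) + 1) ≤ L := by exact_mod_cast this
    linarith
  rw [profile]
  have hinv : 0 < Ψ⁻¹ := inv_pos.2 hΨ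
  rcases le_total 1 Ψ with h | h
  · have := Real.rpow_le_one_of_one_le_of_nonpos h (neg_nonpos.2 ht0)
    linarith
  · have := Real.rpow_le_rpow_of_exponent_ge hΨ h (neg_le_neg ht1)
    rw [Real.rpow_neg_one] at this
    linarith

theorem tendsto_profile {Ψ : ℝ} (hΨ : 0 < Ψ) {L j : ℕ → ℕ} (hL : Tendsto L atTop atTop) {x : ℝ}
    (hj : Tendsto (fun n => (j n : ℝ) / L n) atTop (𝓝 x)) :
    Tendsto (fun n => profile Ψ (L n) (j n)) atTop (𝓝 (Real.exp (-Real.log Ψ * x))) := by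
  have hLr : Tendsto (fun n => (L n : ℝ)) atTop atTop := tendsto_natCast_atTop_atTop.comp hL
  have h1 : Tendsto (fun n => 1 - 1 / (L n : ℝ)) atTop (𝓝 (1 - 0)) :=
    tendsto_const_nhds.sub (tendsto_const_nhds.div_atTop hLr)
  have h2 : Tendsto (fun n => (j n : ℝ) / ((L n : ℝ) - 1)) atTop (𝓝 x) := by
    have := hj.div h1 (by norm_num)
    rw [sub_zero, div_one] at this
    refine this.congr' ?_
    filter_upwards [hLr.eventually_gt_atTop 1] with n hn
    have h3 : (L n : ℝ) - 1 ≠ 0 := by linarith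
    have h4 : (L n : ℝ) ≠ 0 := by linarith
    simp only [Pi.div_apply]
    field_simp
  have h3 := (Real.continuous_exp.tendsto _).comp ((h2.const_mul (-Real.log Ψ)))
  refine h3.congr fun n => ?_
  rw [Function.comp, profile, Real.rpow_def_of_pos hΨ]
  congr 1
  ring

theorem tendsto_floor_div {L : ℕ → ℕ} (hL : Tendsto L atTop atTop) {x : ℝ} (hx : 0 ≤ x) :
    Tendsto (fun n => (⌊(L n : ℝ) * x⌋₊ : ℝ) / L n) atTop (𝓝 x) := by
  have := (tendsto_nat_floor_mul_div_atTop hx).comp (tendsto_natCast_atTop_atTop.comp hL)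
  refine this.congr fun n => ?_
  simp [mul_comm]

theorem tendsto_sum_profile {Ψ : ℝ} (hΨ : 0 < Ψ) {L A : ℕ → ℕ} (hL : Tendsto L atTop atTop)
    (hL0 : ∀ n, 0 < L n) (hAL : ∀ n, A n ≤ L n) {a : ℝ}
    (hA : Tendsto (fun n => (A n : ℝ) / L n) atTop (𝓝 a)) :
    Tendsto (fun n => (∑ i ∈ Finset.range (A n), profile Ψ (L n) i) / L n) atTop
      (𝓝 (∫ x in 0..a, Real.exp (-Real.log Ψ * x))) := by
  refine tendsto_sum_div hL0 hA (C := 1 + Ψ⁻¹) (by positivity) (fun n i hi => ?_)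
    fun x hx _ => tendsto_profile hΨ hL (tendsto_floor_div hL hx.le)
  rw [abs_of_pos (profile_pos hΨ _ _)]
  exact profile_le hΨ (hi.trans_le (hAL n))

theorem tendsto_lagWeight {L Nc i j : ℕ → ℕ} (hL0 : ∀ n, 0 < L n)
    {β x y : ℝ} (hβ : 0 < β) (hN : Tendsto (fun n => (Nc n : ℝ) / L n) atTop (𝓝 β))
    (hi : Tendsto (fun n => (i n : ℝ) / L n) atTop (𝓝 x))
    (hj : Tendsto (fun n => (j n : ℝ) / L n) atTop (𝓝 y)) (hij : ∀ n, i n ≤ j n) :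
    Tendsto (fun n => lagWeight (Nc n) (j n - i n)) atTop (𝓝 (min (y - x) β / β)) := by
  refine (((hj.sub hi).min hN).div hN hβ.ne').congr fun n => ?_
  have hLn : (0 : ℝ) < L n := by exact_mod_cast hL0 n
  simp only [Pi.div_apply]
  rw [lagWeight, Nat.cast_min, Nat.cast_sub (hij n), ← sub_div, min_div_div_right hLn.le,
    div_div_div_cancel_right₀ hLn.ne']

/-- The limit, up to the factor `β`, of the expected energy of all pairs of paths below `a`. -/
def pairIntegral (β : ℝ) (t a : ℝ) : ℝ :=
  ∫ y in 0..a, Real.exp (-t * y) * ∫ x in 0..y, Real.exp (-t * x) * min (y - x) β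

/-- The weighted sum over all pairs of paths below `A`. -/
def pairSum (Ψ : ℝ) (L Nc A : ℕ) : ℝ :=
  ∑ j ∈ Finset.range A, ∑ i ∈ Finset.range j,
    lagWeight Nc (j - i) * (profile Ψ L i * profile Ψ L j)

/-- Two nested applications of `tendsto_sum_div`: the inner sum over `L` converges at each fixed `y`
and is bounded by `c`, so it can be part of the outer summand. -/
theorem tendsto_pairSum {Ψ : ℝ} (hΨ : 0 < Ψ) {L A Nc : ℕ → ℕ} (hL : Tendsto L atTop atTop)
    (hL0 : ∀ n, 0 < L n) (hAL : ∀ n, A n ≤ L n) {a β : ℝ} (hβ : 0 < β)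
    (hA : Tendsto (fun n => (A n : ℝ) / L n) atTop (𝓝 a))
    (hN : Tendsto (fun n => (Nc n : ℝ) / L n) atTop (𝓝 β)) :
    Tendsto (fun n => pairSum Ψ (L n) (Nc n) (A n) / (L n : ℝ) ^ 2) atTop
      (𝓝 (pairIntegral β (Real.log Ψ) a / β)) := by
  have hLR : ∀ n, (0 : ℝ) < L n := fun n => by exact_mod_cast hL0 n
  have ha1 : a ≤ 1 := le_of_tendsto' hA fun n => by
    rw [div_le_one (hLR n)]; exact_mod_cast hAL n
  set c : ℝ := 1 + Ψ⁻¹ with hc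
  have hc0 : 0 ≤ c := by positivity
  have hbd : ∀ n i j : ℕ, i < L n → |lagWeight (Nc n) (j - i) * profile Ψ (L n) i| ≤ c := by
    intro n i j hi
    rw [abs_of_nonneg (mul_nonneg (lagWeight_nonneg _ _) (profile_pos hΨ _ _).le)]
    have h1 := lagWeight_le_one (Nc n) (j - i)
    have h2 := profile_le hΨ hi
    have h3 := (profile_pos hΨ (L n) i).le
    have h4 := lagWeight_nonneg (Nc n) (j - i)
    nlinarith
  have hinner : ∀ y, 0 < y → y < a → Tendsto (fun n => (∑ i ∈ Finset.range ⌊(L n : ℝ) * y⌋₊,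
      lagWeight (Nc n) (⌊(L n : ℝ) * y⌋₊ - i) * profile Ψ (L n) i) / L n) atTop
      (𝓝 (∫ x in 0..y, min (y - x) β / β * Real.exp (-Real.log Ψ * x))) := by
    intro y hy hya
    refine tendsto_sum_div hL0 (tendsto_floor_div hL hy.le) hc0 (fun n i hi => ?_)
      fun x hx hxy => ?_
    · refine hbd n i _ (hi.trans_le ?_)
      exact Nat.floor_le_of_le (by nlinarith [hLR n])
    · refine (tendsto_lagWeight hL0 hβ hN (tendsto_floor_div hL hx.le)
        (tendsto_floor_div hL hy.le) fun n => ?_).mul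
        (tendsto_profile hΨ hL (tendsto_floor_div hL hx.le))
      exact Nat.floor_le_floor (mul_le_mul_of_nonneg_left hxy.le (hLR n).le)
  have houter := tendsto_sum_div hL0 hA (C := c * c) (by positivity)
    (f := fun n j => profile Ψ (L n) j * ((∑ i ∈ Finset.range j,
      lagWeight (Nc n) (j - i) * profile Ψ (L n) i) / L n))
    (g := fun y => Real.exp (-Real.log Ψ * y) *
      ∫ x in 0..y, min (y - x) β / β * Real.exp (-Real.log Ψ * x))
    (fun n j hj => by
      have hjL : j < L n := hj.trans_le (hAL n)
      rw [abs_mul, abs_of_pos (profile_pos hΨ _ _)]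
      refine mul_le_mul (profile_le hΨ hjL) ?_ (abs_nonneg _) hc0
      rw [abs_div, abs_of_pos (hLR n), div_le_iff₀ (hLR n)]
      refine (Finset.abs_sum_le_sum_abs _ _).trans ((Finset.sum_le_sum fun i hi =>
        hbd n i j ((Finset.mem_range.1 hi).trans hjL)).trans ?_)
      rw [Finset.sum_const, Finset.card_range, nsmul_eq_mul, mul_comm]
      exact mul_le_mul_of_nonneg_left (by exact_mod_cast hjL.le) hc0)
    fun y hy hya => (tendsto_profile hΨ hL (tendsto_floor_div hL hy.le)).mul (hinner y hy hya)
  have hval : ∫ y in 0..a, Real.exp (-Real.log Ψ * y) *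
      ∫ x in 0..y, min (y - x) β / β * Real.exp (-Real.log Ψ * x)
      = pairIntegral β (Real.log Ψ) a / β := by
    rw [pairIntegral, ← intervalIntegral.integral_div]
    congr 1
    ext y
    rw [mul_div_assoc, ← intervalIntegral.integral_div]
    congr 2
    ext x
    ring
  rw [← hval]
  refine houter.congr fun n => ?_
  rw [pairSum, pow_two, ← div_div]
  congr 1
  rw [Finset.sum_div]
  refine Finset.sum_congr rfl fun j _ => ?_
  rw [← mul_div_assoc, Finset.mul_sum]
  congr 1
  exact Finset.sum_congr rfl fun i _ => by ring

theorem sum_sum_ite_lt (n : ℕ) (G : ℕ → ℕ → ℝ) :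
    ∑ i : Fin n, ∑ j : Fin n, (if i < j then G i j else 0)
      = ∑ j ∈ Finset.range n, ∑ i ∈ Finset.range j, G i j := by
  rw [Finset.sum_comm]
  simp only [Fin.lt_def]
  rw [Fin.sum_univ_eq_sum_range (fun j => ∑ i : Fin n, if (i : ℕ) < j then G i j else 0)]
  refine Finset.sum_congr rfl fun j hj => ?_
  rw [Fin.sum_univ_eq_sum_range (fun i => if i < j then G i j else 0), ← Finset.sum_filter]
  refine Finset.sum_congr ?_ fun _ _ => rfl
  ext i
  simp only [Finset.mem_range, Finset.mem_filter] at *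
  omega

/-- The weight `(finger + finger)²` is `4`, `1` or `0` according to whether two, one or none of the
paths have a finger. The mixed pairs are all pairs minus those below `LP` minus those above, and the
latter are a rescaled copy of the pairs below `L - LP`. -/
theorem expected_siEnergy {Ψ : ℝ} (hΨ : 0 < Ψ) (s : ℝ) {L LP : ℕ} (hLP : LP ≤ L) (Nc : ℕ) :
    ∑ i : Fin L, ∑ j : Fin L,
        (if i < j then lagWeight Nc ((j : ℕ) - i) * (finger LP j + finger LP i) ^ 2 else 0) *
          (pathVar s Ψ L i * pathVar s Ψ L j)
      = s ^ 2 * (3 * pairSum Ψ L Nc LP + pairSum Ψ L Nc L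
          - profile Ψ L LP ^ 2 * pairSum Ψ L Nc (L - LP)) := by
  obtain ⟨B, rfl⟩ := Nat.exists_eq_add_of_le hLP
  rw [Nat.add_sub_cancel_left]
  set M := LP + B with hM
  set g : ℕ → ℕ → ℝ := fun i j => lagWeight Nc (j - i) * (profile Ψ M i * profile Ψ M j) with hg
  have h1 : ∑ i : Fin M, ∑ j : Fin M,
        (if i < j then lagWeight Nc ((j : ℕ) - i) * (finger LP j + finger LP i) ^ 2 else 0) *
          (pathVar s Ψ M i * pathVar s Ψ M j)
      = s ^ 2 * ∑ j ∈ Finset.range M, ∑ i ∈ Finset.range j,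
        (finger LP j + finger LP i) ^ 2 * g i j := by
    rw [← sum_sum_ite_lt M fun i j => (finger LP j + finger LP i) ^ 2 * g i j, Finset.mul_sum]
    refine Finset.sum_congr rfl fun i _ => ?_
    rw [Finset.mul_sum]
    refine Finset.sum_congr rfl fun j _ => ?_
    have e : ∀ l : Fin M, pathVar s Ψ M l = s * profile Ψ M l := fun l => rfl
    rw [e, e, hg]
    split_ifs
    · ring
    · simp
  have h2 : ∀ i j, g (LP + i) (LP + j) = profile Ψ M LP ^ 2 * g i j := by
    intro i j
    simp only [hg, profile_add hΨ]
    rw [show LP + j - (LP + i) = j - i by omega]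
    ring
  have hT : ∀ A, pairSum Ψ M Nc A = ∑ j ∈ Finset.range A, ∑ i ∈ Finset.range j, g i j :=
    fun A => rfl
  have h3 : pairSum Ψ M Nc M = pairSum Ψ M Nc LP
      + ∑ j ∈ Finset.range B, ∑ i ∈ Finset.range LP, g i (LP + j)
      + profile Ψ M LP ^ 2 * pairSum Ψ M Nc B := by
    rw [hT, hM, Finset.sum_range_add, ← hM, hT, hT, add_assoc, Finset.mul_sum,
      ← Finset.sum_add_distrib]
    congr 1
    refine Finset.sum_congr rfl fun j _ => ?_
    rw [Finset.sum_range_add, Finset.mul_sum]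
    congr 1
    exact Finset.sum_congr rfl fun i _ => h2 i j
  have h4 : ∑ j ∈ Finset.range M, ∑ i ∈ Finset.range j, (finger LP j + finger LP i) ^ 2 * g i j
      = 4 * pairSum Ψ M Nc LP
        + ∑ j ∈ Finset.range B, ∑ i ∈ Finset.range LP, g i (LP + j) := by
    rw [hM, Finset.sum_range_add, ← hM, hT, Finset.mul_sum]
    congr 1
    · refine Finset.sum_congr rfl fun j hj => ?_
      rw [Finset.mul_sum]
      refine Finset.sum_congr rfl fun i hi => ?_
      rw [Finset.mem_range] at hi hj
      rw [finger, finger, if_pos hj, if_pos (hi.trans hj)]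
      norm_num
    · refine Finset.sum_congr rfl fun j _ => ?_
      rw [Finset.sum_range_add, Finset.sum_eq_zero (s := Finset.range j), add_zero]
      · refine Finset.sum_congr rfl fun i hi => ?_
        rw [Finset.mem_range] at hi
        rw [finger, finger, if_neg (by omega), if_pos hi]
        norm_num
      · intro i _
        rw [finger, finger, if_neg (by omega), if_neg (by omega)]
        norm_num
  rw [h1, h4, h3]
  ring

theorem sum_finger_mul (s Ψ : ℝ) {L LP : ℕ} (hLP : LP ≤ L) :
    ∑ l : Fin L, finger LP l * pathVar s Ψ L l
      = s * ∑ i ∈ Finset.range LP, profile Ψ L i := by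
  have e : ∀ l : Fin L, finger LP l * pathVar s Ψ L l
      = (fun i : ℕ => if i < LP then s * profile Ψ L i else 0) l := fun l => by
    simp only [finger, pathVar, profile]; split_ifs <;> simp
  simp only [e]
  rw [Fin.sum_univ_eq_sum_range (fun i : ℕ => if i < LP then s * profile Ψ L i else 0),
    ← Finset.sum_filter, Finset.mul_sum]
  refine Finset.sum_congr ?_ fun _ _ => rfl
  ext i
  simp only [Finset.mem_range, Finset.mem_filter]
  omega

end Riemann

/-! ### Closed forms of the limits -/

section ClosedForm

/-- The expected power below `a`. -/
def powerIntegral (t a : ℝ) : ℝ := ∫ x in 0..a, Real.exp (-t * x)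

/-- The limit of the expected self-interference, up to the factor `β`. -/
def siIntegral (ρ β t : ℝ) : ℝ :=
  3 * pairIntegral β t ρ + pairIntegral β t 1
    - Real.exp (-t * ρ) ^ 2 * pairIntegral β t (1 - ρ)

theorem hasDerivAt_exp_mul (t x : ℝ) :
    HasDerivAt (fun x => Real.exp (-t * x)) (-t * Real.exp (-t * x)) x := by
  have := ((hasDerivAt_id x).const_mul (-t)).exp
  simpa [mul_comm] using this

theorem powerIntegral_eq {t : ℝ} (ht : t ≠ 0) (a : ℝ) :
    powerIntegral t a = (1 - Real.exp (-t * a)) / t := by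
  have h : ∀ x ∈ Set.uIcc 0 a, HasDerivAt (fun x => -Real.exp (-t * x) / t)
      (Real.exp (-t * x)) x := fun x _ => by
    refine ((hasDerivAt_exp_mul t x).neg.div_const t).congr_deriv ?_
    field_simp
  rw [powerIntegral, intervalIntegral.integral_eq_sub_of_hasDerivAt h
    (Continuous.intervalIntegrable (by fun_prop) _ _)]
  simp; ring

theorem powerIntegral_pos {t a : ℝ} (ha : 0 < a) : 0 < powerIntegral t a :=
  intervalIntegral.intervalIntegral_pos_of_pos
    (Continuous.intervalIntegrable (by fun_prop) _ _) (fun _ => Real.exp_pos _) ha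

theorem integral_exp_mul_sub {t : ℝ} (ht : t ≠ 0) (a y : ℝ) :
    ∫ x in a..y, Real.exp (-t * x) * (y - x)
      = Real.exp (-t * y) / t ^ 2 + Real.exp (-t * a) * ((y - a) / t - 1 / t ^ 2) := by
  have h : ∀ x ∈ Set.uIcc a y, HasDerivAt
      (fun x => Real.exp (-t * x) * (-(y - x) / t + 1 / t ^ 2))
      (Real.exp (-t * x) * (y - x)) x := fun x _ => by
    have h1 : HasDerivAt (fun x => -(y - x) / t + 1 / t ^ 2) (1 / t) x := by
      have := ((((hasDerivAt_id x).const_sub y).neg.div_const t).add_const (1 / t ^ 2))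
      simpa using this
    refine ((hasDerivAt_exp_mul t x).mul h1).congr_deriv ?_
    field_simp
    ring
  rw [intervalIntegral.integral_eq_sub_of_hasDerivAt h
    (Continuous.intervalIntegrable (by fun_prop) _ _)]
  ring

theorem inner_integral_of_le {t β y : ℝ} (ht : t ≠ 0) (hy : 0 ≤ y) (hyβ : y ≤ β) :
    ∫ x in 0..y, Real.exp (-t * x) * min (y - x) β
      = y / t - 1 / t ^ 2 + Real.exp (-t * y) / t ^ 2 := by
  have : ∫ x in 0..y, Real.exp (-t * x) * min (y - x) β
      = ∫ x in 0..y, Real.exp (-t * x) * (y - x) := by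
    refine intervalIntegral.integral_congr fun x hx => ?_
    rw [Set.uIcc_of_le hy] at hx
    rw [min_eq_left (by linarith [hx.1])]
  rw [this, integral_exp_mul_sub ht]
  simp; ring

theorem inner_integral_of_ge {t β y : ℝ} (ht : t ≠ 0) (hβ : 0 ≤ β) (hyβ : β ≤ y) :
    ∫ x in 0..y, Real.exp (-t * x) * min (y - x) β
      = β / t + Real.exp (-t * y) / t ^ 2 * (1 - Real.exp (t * β)) := by
  have hc : Continuous fun x => Real.exp (-t * x) * min (y - x) β := by fun_prop
  -- The minimum changes branch at `x = y - β`.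
  rw [← intervalIntegral.integral_add_adjacent_intervals (b := y - β)
    (hc.intervalIntegrable _ _) (hc.intervalIntegrable _ _)]
  have h1 : ∫ x in 0..(y - β), Real.exp (-t * x) * min (y - x) β
      = powerIntegral t (y - β) * β := by
    rw [powerIntegral, ← intervalIntegral.integral_mul_const]
    refine intervalIntegral.integral_congr fun x hx => ?_
    rw [Set.uIcc_of_le (by linarith)] at hx
    rw [min_eq_right (by linarith [hx.2])]
  have h2 : ∫ x in (y - β)..y, Real.exp (-t * x) * min (y - x) β
      = ∫ x in (y - β)..y, Real.exp (-t * x) * (y - x) := by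
    refine intervalIntegral.integral_congr fun x hx => ?_
    rw [Set.uIcc_of_le (by linarith)] at hx
    rw [min_eq_left (by linarith [hx.1])]
  have h3 : Real.exp (-t * (y - β)) = Real.exp (-t * y) * Real.exp (t * β) := by
    rw [← Real.exp_add]; congr 1; ring
  rw [h1, h2, integral_exp_mul_sub ht, powerIntegral_eq ht, h3]
  field_simp
  ring

theorem continuous_inner_integral (β : ℝ) :
    Continuous fun p : ℝ × ℝ => ∫ x in 0..p.2, Real.exp (-p.1 * x) * min (p.2 - x) β := by
  refine intervalIntegral.continuous_parametric_intervalIntegral_of_continuous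
    (f := fun (p : ℝ × ℝ) x => Real.exp (-p.1 * x) * min (p.2 - x) β) ?_ continuous_snd
  simp only [Function.uncurry_def]
  fun_prop

theorem continuous_pairIntegral (β a : ℝ) : Continuous fun t => pairIntegral β t a := by
  refine intervalIntegral.continuous_parametric_intervalIntegral_of_continuous'
    (f := fun t y => Real.exp (-t * y) * ∫ x in 0..y, Real.exp (-t * x) * min (y - x) β) ?_ 0 a
  have := continuous_inner_integral β
  simp only [Function.uncurry_def]
  fun_prop

theorem continuous_powerIntegral (a : ℝ) : Continuous fun t => powerIntegral t a := by
  refine intervalIntegral.continuous_parametric_intervalIntegral_of_continuous'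
    (f := fun t x => Real.exp (-t * x)) ?_ 0 a
  simp only [Function.uncurry_def]
  fun_prop

/-- Continuity at `t = 0` gives the value for the flat profile without expanding the closed forms.
-/
theorem continuous_siIntegral (ρ β : ℝ) : Continuous (siIntegral ρ β) := by
  have h := continuous_pairIntegral β
  unfold siIntegral
  have h1 := h ρ
  have h2 := h 1
  have h3 := h (1 - ρ)
  fun_prop

theorem pairIntegral_of_le {t β a : ℝ} (ht : t ≠ 0) (ha : 0 ≤ a) (haβ : a ≤ β) :
    pairIntegral β t a = 1 / (2 * t ^ 3) - a * Real.exp (-t * a) / t ^ 2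
      - Real.exp (-t * a) ^ 2 / (2 * t ^ 3) := by
  have e : pairIntegral β t a = ∫ y in 0..a, Real.exp (-t * y) *
      (y / t - 1 / t ^ 2 + Real.exp (-t * y) / t ^ 2) := by
    refine intervalIntegral.integral_congr fun y hy => ?_
    rw [Set.uIcc_of_le ha] at hy
    rw [inner_integral_of_le ht hy.1 (hy.2.trans haβ)]
  have h : ∀ y ∈ Set.uIcc 0 a, HasDerivAt
      (fun y => -y * Real.exp (-t * y) / t ^ 2 - Real.exp (-t * y) ^ 2 / (2 * t ^ 3))
      (Real.exp (-t * y) * (y / t - 1 / t ^ 2 + Real.exp (-t * y) / t ^ 2)) y := fun y _ => by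
    have h1 := hasDerivAt_exp_mul t y
    refine ((((hasDerivAt_id y).neg.mul h1).div_const (t ^ 2)).sub
      ((h1.pow 2).div_const (2 * t ^ 3))).congr_deriv ?_
    simp only [Pi.neg_apply, id]
    field_simp
    ring
  rw [e, intervalIntegral.integral_eq_sub_of_hasDerivAt h
    (Continuous.intervalIntegrable (by fun_prop) _ _)]
  simp; ring

theorem pairIntegral_of_ge {t β a : ℝ} (ht : t ≠ 0) (hβ : 0 ≤ β) (haβ : β ≤ a) :
    pairIntegral β t a = 1 / (2 * t ^ 3) - β * Real.exp (-t * a) / t ^ 2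
      - Real.exp (-t * β) / (2 * t ^ 3)
      - Real.exp (-t * a) ^ 2 * (1 - Real.exp (t * β)) / (2 * t ^ 3) := by
  have hc : Continuous fun y => Real.exp (-t * y) *
      ∫ x in 0..y, Real.exp (-t * x) * min (y - x) β := by
    have := (continuous_inner_integral β).comp (Continuous.prodMk_right t)
    simp only [Function.comp_def] at this
    fun_prop
  -- The inner integral changes form at `y = β`; the part below `β` is the previous case with `a =
  -- β`.
  have e : pairIntegral β t a = pairIntegral β t β + ∫ y in β..a, Real.exp (-t * y) *
      (β / t + Real.exp (-t * y) / t ^ 2 * (1 - Real.exp (t * β))) := by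
    rw [pairIntegral, pairIntegral, ← intervalIntegral.integral_add_adjacent_intervals (b := β)
      (hc.intervalIntegrable _ _) (hc.intervalIntegrable _ _)]
    congr 1
    refine intervalIntegral.integral_congr fun y hy => ?_
    rw [Set.uIcc_of_le haβ] at hy
    rw [inner_integral_of_ge ht hβ hy.1]
  have h : ∀ y ∈ Set.uIcc β a, HasDerivAt
      (fun y => -β * Real.exp (-t * y) / t ^ 2
        - Real.exp (-t * y) ^ 2 * (1 - Real.exp (t * β)) / (2 * t ^ 3))
      (Real.exp (-t * y) * (β / t + Real.exp (-t * y) / t ^ 2 * (1 - Real.exp (t * β)))) y :=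
    fun y _ => by
    have h1 := hasDerivAt_exp_mul t y
    refine (((h1.const_mul (-β)).div_const (t ^ 2)).sub
      (((h1.pow 2).mul_const (1 - Real.exp (t * β))).div_const (2 * t ^ 3))).congr_deriv ?_
    field_simp
    ring
  rw [e, pairIntegral_of_le ht hβ le_rfl, intervalIntegral.integral_eq_sub_of_hasDerivAt h
    (Continuous.intervalIntegrable (by fun_prop) _ _)]
  have h3 : Real.exp (-t * β) ^ 2 * Real.exp (t * β) = Real.exp (-t * β) := by
    rw [pow_two, mul_assoc, ← Real.exp_add]; simp
  linear_combination (-(1 / (2 * t ^ 3))) * h3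

theorem muForm_eq {Ψ ρ : ℝ} (hΨ : 0 < Ψ) (hΨ1 : Ψ ≠ 1) (hρ : 0 < ρ) :
    muForm Ψ ρ = powerIntegral (Real.log Ψ) 1 / powerIntegral (Real.log Ψ) ρ := by
  have ht : Real.log Ψ ≠ 0 := Real.log_ne_zero_of_pos_of_ne_one hΨ hΨ1
  have e1 : Real.exp (-Real.log Ψ * 1) = Ψ⁻¹ := by
    rw [mul_one, Real.exp_neg, Real.exp_log hΨ]
  have eρ : Real.exp (-Real.log Ψ * ρ) = (Ψ ^ ρ)⁻¹ := by
    rw [neg_mul, Real.exp_neg, ← Real.rpow_def_of_pos hΨ]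
  have hr : Ψ ^ ρ ≠ 1 := fun h => by
    have := Real.log_rpow hΨ ρ
    rw [h, Real.log_one] at this
    exact mul_ne_zero hρ.ne' ht this.symm
  have hr0 : 0 < Ψ ^ ρ := Real.rpow_pos_of_pos hΨ ρ
  have hr1 : Ψ ^ ρ - 1 ≠ 0 := sub_ne_zero.2 hr
  rw [muForm, powerIntegral_eq ht, powerIntegral_eq ht, e1, eρ, Real.rpow_sub hΨ, Real.rpow_one]
  have : 1 - (Ψ ^ ρ)⁻¹ ≠ 0 := by
    rw [sub_ne_zero]; intro h; apply hr; rw [← inv_inv (Ψ ^ ρ), ← h, inv_one]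
  field_simp

/-- The five cases are the possible positions of `β` relative to `ρ`, `1 - ρ` and `1`, which decide
the form of each `pairIntegral`. In each case the claim is then an identity of rational functions in
`Ψ`, `Ψ ^ ρ`, `Ψ ^ β` and `log Ψ`. -/
theorem nuForm_eq {Ψ ρ β : ℝ} (hΨ : 0 < Ψ) (hΨ1 : Ψ ≠ 1) (hρ : 0 < ρ) (hρ1 : ρ ≤ 1)
    (hβ : 0 < β) :
    nuForm Ψ ρ β = siIntegral ρ β (Real.log Ψ) / β / powerIntegral (Real.log Ψ) ρ ^ 2 := by
  have ht : Real.log Ψ ≠ 0 := Real.log_ne_zero_of_pos_of_ne_one hΨ hΨ1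
  have hexp : ∀ x : ℝ, Real.exp (-Real.log Ψ * x) = (Ψ ^ x)⁻¹ := fun x => by
    rw [neg_mul, Real.exp_neg, ← Real.rpow_def_of_pos hΨ]
  have eβ : Real.exp (Real.log Ψ * β) = Ψ ^ β := (Real.rpow_def_of_pos hΨ β).symm
  have hr : Ψ ^ ρ ≠ 1 := fun h => by
    have := Real.log_rpow hΨ ρ
    rw [h, Real.log_one] at this
    exact mul_ne_zero hρ.ne' ht this.symm
  have hr0 : 0 < Ψ ^ ρ := Real.rpow_pos_of_pos hΨ ρ
  have hb0 : 0 < Ψ ^ β := Real.rpow_pos_of_pos hΨ β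
  have hr1 : Ψ ^ ρ - 1 ≠ 0 := sub_ne_zero.2 hr
  have h2 : ∀ x : ℝ, Ψ ^ (2 * x) = (Ψ ^ x) ^ 2 := fun x => by
    rw [mul_comm, Real.rpow_mul hΨ.le]; norm_cast
  have hadd : ∀ x y : ℝ, Ψ ^ (x + y) = Ψ ^ x * Ψ ^ y := fun x y => Real.rpow_add hΨ x y
  have hp2 : Ψ ^ (2 : ℝ) = Ψ ^ 2 := by norm_cast
  have hsub : Ψ ^ (1 - ρ) = Ψ / Ψ ^ ρ := by rw [Real.rpow_sub hΨ, Real.rpow_one]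
  rw [siIntegral, powerIntegral_eq ht, hexp ρ, nuForm]
  have hD : (1 - (Ψ ^ ρ)⁻¹) = (Ψ ^ ρ - 1) / Ψ ^ ρ := by field_simp
  rw [hD]
  by_cases c1 : β ≤ min ρ (1 - ρ)
  · obtain ⟨h1, h1'⟩ := le_min_iff.1 c1
    rw [if_pos c1, pairIntegral_of_ge ht hβ.le h1, pairIntegral_of_ge ht hβ.le (h1.trans hρ1),
      pairIntegral_of_ge ht hβ.le h1', nuForm₁]
    simp only [hexp, hsub, eβ, Real.rpow_one, h2, hadd]
    generalize Ψ ^ ρ = r at *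
    generalize Ψ ^ β = b at *
    generalize Real.log Ψ = t at *
    field_simp
    ring
  rw [if_neg c1]
  by_cases c2 : ρ ≤ β ∧ β ≤ 1 - ρ
  · rw [if_pos c2, pairIntegral_of_le ht hρ.le c2.1,
      pairIntegral_of_ge ht hβ.le (c2.2.trans (by linarith)),
      pairIntegral_of_ge ht hβ.le c2.2, nuForm₂]
    simp only [hexp, hsub, eβ, Real.rpow_one, h2, hadd]
    generalize Ψ ^ ρ = r at *
    generalize Ψ ^ β = b at *
    generalize Real.log Ψ = t at *
    field_simp
    ring
  rw [if_neg c2]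
  by_cases c3 : 1 - ρ ≤ β ∧ β ≤ ρ
  · rw [if_pos c3, pairIntegral_of_ge ht hβ.le c3.2,
      pairIntegral_of_ge ht hβ.le (c3.2.trans hρ1),
      pairIntegral_of_le ht (by linarith) c3.1, nuForm₃]
    simp only [hexp, hsub, eβ, Real.rpow_one, h2, hadd, hp2]
    generalize Ψ ^ ρ = r at *
    generalize Ψ ^ β = b at *
    generalize Real.log Ψ = t at *
    field_simp
    ring
  rw [if_neg c3]
  by_cases c4 : max ρ (1 - ρ) ≤ β ∧ β ≤ 1
  · obtain ⟨h1, h1'⟩ := max_le_iff.1 c4.1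
    rw [if_pos c4, pairIntegral_of_le ht hρ.le h1, pairIntegral_of_ge ht hβ.le c4.2,
      pairIntegral_of_le ht (by linarith) h1', nuForm₄]
    simp only [hexp, hsub, eβ, Real.rpow_one, h2, hadd, hp2]
    generalize Ψ ^ ρ = r at *
    generalize Ψ ^ β = b at *
    generalize Real.log Ψ = t at *
    field_simp
    ring
  -- The first four ranges exhaust `β ≤ 1`.
  · have h1 : 1 ≤ β := by
      by_contra! h
      rcases le_total β ρ with h3 | h3
      · rcases le_total β (1 - ρ) with h4 | h4
        · exact c1 (le_min h3 h4)
        · exact c3 ⟨h4, h3⟩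
      · rcases le_total β (1 - ρ) with h4 | h4
        · exact c2 ⟨h3, h4⟩
        · exact c4 ⟨max_le h3 h4, h.le⟩
    rw [if_neg c4, pairIntegral_of_le ht hρ.le (hρ1.trans h1),
      pairIntegral_of_le ht zero_le_one h1,
      pairIntegral_of_le ht (by linarith) (by linarith), nuForm₅]
    simp only [hexp, hsub, Real.rpow_one, h2]
    generalize Ψ ^ ρ = r at *
    generalize Ψ ^ β = b at *
    generalize Real.log Ψ = t at *
    field_simp
    ring

/-- The substitution `t = log ψ` turns the limit `ψ → 1` into continuity at `t = 0`. -/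
theorem limUnder_log {f : ℝ → ℝ} {g : ℝ → ℝ} (hg : ContinuousAt g 0)
    (h : ∀ ψ, 0 < ψ → ψ ≠ 1 → f ψ = g (Real.log ψ)) :
    limUnder (𝓝[≠] (1 : ℝ)) f = g 0 := by
  refine Tendsto.limUnder_eq ?_
  have hlog : Tendsto Real.log (𝓝[≠] (1 : ℝ)) (𝓝 0) := by
    have := (Real.continuousAt_log one_ne_zero).tendsto
    rw [Real.log_one] at this
    exact this.mono_left nhdsWithin_le_nhds
  refine (hg.tendsto.comp hlog).congr' ?_
  have h0 : ∀ᶠ ψ : ℝ in 𝓝[≠] 1, 0 < ψ :=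
    nhdsWithin_le_nhds (lt_mem_nhds one_pos)
  filter_upwards [h0, self_mem_nhdsWithin] with ψ h1 h2
  exact (h ψ h1 h2).symm

theorem mu_eq {Ψ ρ : ℝ} (hΨ : 0 < Ψ) (hρ : 0 < ρ) :
    mu Ψ ρ = powerIntegral (Real.log Ψ) 1 / powerIntegral (Real.log Ψ) ρ := by
  rw [mu]
  split_ifs with h
  · subst h
    rw [Real.log_one]
    exact limUnder_log (g := fun t => powerIntegral t 1 / powerIntegral t ρ)
      ((continuous_powerIntegral 1).continuousAt.div (continuous_powerIntegral ρ).continuousAt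
        (powerIntegral_pos hρ).ne') fun ψ h1 h2 => muForm_eq h1 h2 hρ
  · exact muForm_eq hΨ h hρ

theorem nu_eq {Ψ ρ β : ℝ} (hΨ : 0 < Ψ) (hρ : 0 < ρ) (hρ1 : ρ ≤ 1) (hβ : 0 < β) :
    nu Ψ ρ β = siIntegral ρ β (Real.log Ψ) / β / powerIntegral (Real.log Ψ) ρ ^ 2 := by
  rw [nu]
  split_ifs with h
  · subst h
    rw [Real.log_one]
    exact limUnder_log (g := fun t => siIntegral ρ β t / β / powerIntegral t ρ ^ 2)
      (((continuous_siIntegral ρ β).continuousAt.div_const β).div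
        ((continuous_powerIntegral ρ).continuousAt.pow 2)
        (pow_ne_zero 2 (powerIntegral_pos hρ).ne')) fun ψ h1 h2 => nuForm_eq h1 h2 hρ hρ1 hβ
  · exact nuForm_eq hΨ h hρ hρ1 hβ

end ClosedForm

/-! ### Almost sure limits of powers and energies -/

section Limits

variable {Ω : Type*} {mΩ : MeasurableSpace Ω} {P : Measure Ω}

theorem ae_tendsto_zero_of_l4Bound_ofReal {f : ℕ → Ω → ℝ} {B : ℕ → ℝ}
    (h : ∀ n, L4Bound P (fun ω => (f n ω : ℂ)) (B n)) {L : ℕ → ℕ} (hL : StrictMono L)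
    (hpos : ∀ n, 0 < L n) {r : ℕ} {C : ℝ} (hB : ∀ n, B n * L n ≤ C * ((L n : ℝ) ^ r) ^ 2) :
    ∀ᵐ ω ∂P, Tendsto (fun n => f n ω / (L n : ℝ) ^ r) atTop (𝓝 0) := by
  filter_upwards [ae_tendsto_zero_of_l4Bound h hL hpos hB] with ω hω
  have := (Complex.continuous_re.tendsto 0).comp hω
  rw [Complex.zero_re] at this
  refine this.congr fun n => ?_
  have e : (f n ω : ℂ) / (L n : ℂ) ^ r = ((f n ω / (L n : ℝ) ^ r : ℝ) : ℂ) := by push_cast; rfl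
  rw [Function.comp, e, Complex.ofReal_re]

variable [IsProbabilityMeasure P] {L : ℕ → ℕ} {Ψ A : ℝ}

theorem ae_tendsto_power (hL : StrictMono L) (hpos : ∀ n, 0 < L n) (hΨ : 0 < Ψ) {s : ℝ}
    {X : (n : ℕ) → Fin (L n) → Ω → ℂ} (hX : ∀ n, Gains P (X n) (pathVar s Ψ (L n)) A)
    {LP : ℕ → ℕ} (hLP : ∀ n, LP n ≤ L n) {ρ : ℝ}
    (hρ : Tendsto (fun n => (LP n : ℝ) / L n) atTop (𝓝 ρ)) :
    ∀ᵐ ω ∂P, Tendsto (fun n => (∑ l : Fin (L n), finger (LP n) l * ‖X n l ω‖ ^ 2) / L n) atTop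
      (𝓝 (s * powerIntegral (Real.log Ψ) ρ)) := by
  have h := ae_tendsto_zero_of_l4Bound_ofReal (r := 1) (C := 4 * A) (fun n =>
    (hX n).power_sub (c := fun l => finger (LP n) l) fun l => by
      rw [Real.norm_of_nonneg (finger_nonneg _ _)]; exact finger_le_one _ _) hL hpos
    fun n => le_of_eq (by ring)
  filter_upwards [h] with ω hω
  have hdet := (tendsto_sum_profile hΨ hL.tendsto_atTop hpos hLP hρ).const_mul s
  have := hω.add hdet
  rw [zero_add] at this
  refine this.congr fun n => ?_
  rw [sum_finger_mul s Ψ (hLP n), pow_one, ← mul_div_assoc, ← add_div, sub_add_cancel]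

theorem ae_tendsto_siEnergy (hL : StrictMono L) (hpos : ∀ n, 0 < L n) (hΨ : 0 < Ψ) {s : ℝ}
    {X : (n : ℕ) → Fin (L n) → Ω → ℂ} (hX : ∀ n, Gains P (X n) (pathVar s Ψ (L n)) A)
    {LP Nc : ℕ → ℕ} (hLP : ∀ n, LP n ≤ L n) {ρ β : ℝ} (hβ : 0 < β)
    (hρ : Tendsto (fun n => (LP n : ℝ) / L n) atTop (𝓝 ρ))
    (hN : Tendsto (fun n => (Nc n : ℝ) / L n) atTop (𝓝 β)) :
    ∀ᵐ ω ∂P, Tendsto (fun n => siEnergy (LP n) (Nc n) (fun l => X n l ω) / (L n : ℝ) ^ 2) atTop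
      (𝓝 (s ^ 2 * (siIntegral ρ β (Real.log Ψ) / β))) := by
  have h := ae_tendsto_zero_of_l4Bound_ofReal (r := 2) (C := 10000000 * A ^ 4) (fun n =>
    (hX n).siEnergy_sub (LP n) (Nc n)) hL hpos fun n => le_of_eq (by ring)
  have hLR : ∀ n, (L n : ℝ) ≠ 0 := fun n => by exact_mod_cast (hpos n).ne'
  have hLt := hL.tendsto_atTop
  have h1 : Tendsto (fun n => (L n : ℝ) / L n) atTop (𝓝 1) :=
    tendsto_const_nhds.congr fun n => (div_self (hLR n)).symm
  have h2 : Tendsto (fun n => ((L n - LP n : ℕ) : ℝ) / L n) atTop (𝓝 (1 - ρ)) :=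
    (h1.sub hρ).congr fun n => by rw [Nat.cast_sub (hLP n), sub_div]
  have hdet := ((((tendsto_pairSum hΨ hLt hpos hLP hβ hρ hN).const_mul 3).add
    (tendsto_pairSum hΨ hLt hpos (fun _ => le_rfl) hβ h1 hN)).sub
    (((tendsto_profile hΨ hLt hρ).pow 2).mul
      (tendsto_pairSum hΨ hLt hpos (fun _ => Nat.sub_le _ _) hβ h2 hN))).const_mul (s ^ 2)
  filter_upwards [h] with ω hω
  have := hω.add hdet
  rw [zero_add] at this
  have e : s ^ 2 * (siIntegral ρ β (Real.log Ψ) / β)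
      = s ^ 2 * (3 * (pairIntegral β (Real.log Ψ) ρ / β) + pairIntegral β (Real.log Ψ) 1 / β
        - Real.exp (-Real.log Ψ * ρ) ^ 2 * (pairIntegral β (Real.log Ψ) (1 - ρ) / β)) := by
    rw [siIntegral]; ring
  rw [e]
  refine this.congr fun n => ?_
  rw [expected_siEnergy hΨ s (hLP n)]
  ring

theorem ae_tendsto_maiEnergy (hL : StrictMono L) (hpos : ∀ n, 0 < L n) (hΨ : 0 < Ψ) {K : ℕ}
    {s : Fin K → ℝ} {X : (n : ℕ) → Fin K × Fin (L n) → Ω → ℂ}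
    (hX : ∀ n, Gains P (X n) (fun p => pathVar (s p.1) Ψ (L n) p.2) A) {k j : Fin K} (hkj : k ≠ j)
    {LP : ℕ → ℕ} (hLP : ∀ n, LP n ≤ L n) {ρ : ℝ}
    (hρ : Tendsto (fun n => (LP n : ℝ) / L n) atTop (𝓝 ρ)) :
    ∀ᵐ ω ∂P, Tendsto (fun n =>
      maiEnergy (LP n) (fun l => X n (k, l) ω) (fun l => X n (j, l) ω) / (L n : ℝ) ^ 2) atTop
      (𝓝 (s k * powerIntegral (Real.log Ψ) ρ * (s j * powerIntegral (Real.log Ψ) 1))) := by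
  have inj : ∀ n (k : Fin K), Function.Injective fun l : Fin (L n) => (k, l) :=
    fun n k => Prod.mk_right_injective k
  have h := ae_tendsto_zero_of_l4Bound_ofReal (r := 2) (C := 10000000 * A ^ 4) (fun n =>
    (hX n).maiEnergy_sub (e := fun l => (j, l)) (f := fun l => (k, l)) (inj n j) (inj n k)
      (fun i i' h => hkj (Prod.ext_iff.1 h).1.symm) (LP n)) hL hpos fun n => le_of_eq (by ring)
  have hLR : ∀ n, (L n : ℝ) ≠ 0 := fun n => by exact_mod_cast (hpos n).ne'
  have h1 : Tendsto (fun n => (L n : ℝ) / L n) atTop (𝓝 1) :=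
    tendsto_const_nhds.congr fun n => (div_self (hLR n)).symm
  have hk := ae_tendsto_power hL hpos hΨ (s := s k) (X := fun n l => X n (k, l))
    (fun n => (hX n).precomp (inj n k)) hLP hρ
  have hj := ae_tendsto_power hL hpos hΨ (s := s j) (X := fun n l => X n (j, l))
    (fun n => (hX n).precomp (inj n j)) (fun _ => le_rfl) h1
  filter_upwards [h, hk, hj] with ω h hk hj
  have := h.add (hk.mul hj)
  rw [zero_add] at this
  refine this.congr fun n => ?_
  -- The total power of the interferer is the power of a Rake with all `L n` fingers.
  have e : ∑ l : Fin (L n), finger (L n) l * ‖X n (j, l) ω‖ ^ 2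
      = ∑ l : Fin (L n), ‖X n (j, l) ω‖ ^ 2 :=
    Finset.sum_congr rfl fun l _ => by rw [finger, if_pos l.isLt, one_mul]
  rw [e, div_mul_div_comm, ← pow_two, ← add_div, sub_add_cancel]

end Limits
end PRake

end

/-! ### The two ratios -/

theorem proposition1
    {Ω : Type*} [MeasurableSpace Ω] (P : Measure Ω) [IsProbabilityMeasure P]
    -- finite numbers of users and of pulses per symbol
    (K Nf : ℕ) (hNf : 0 < Nf)
    -- numbers of paths, of fingers and of pulse positions per frame
    (L LP Nc : ℕ → ℕ) (hL : StrictMono L)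
    (hLP : ∀ n, 0 < LP n ∧ LP n ≤ L n) (hNc : ∀ n, 0 < Nc n)
    (ρ β : ℝ) (hρ : 0 < ρ) (hρ1 : ρ ≤ 1) (hβ : 0 < β)
    (hLPρ : Tendsto (fun n => (LP n : ℝ) / (L n : ℝ)) atTop (𝓝 ρ))
    (hNcβ : Tendsto (fun n => (Nc n : ℝ) / (L n : ℝ)) atTop (𝓝 β))
    -- power delay profile
    (Ψ : ℝ) (hΨ : 0 < Ψ) (s : Fin K → ℝ) (hs : ∀ k, 0 < s k)
    -- path gains: for each `n` independent complex Gaussians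
    (α : (n : ℕ) → Fin K → Fin (L n) → Ω → ℂ)
    (hlaw : ∀ n k l, HasLaw (α n k l) (PRake.circGaussian (PRake.pathVar (s k) Ψ (L n) l)) P)
    (hindep : ∀ n, iIndepFun (fun p : Fin K × Fin (L n) => α n p.1 p.2) P)
    (k : Fin K) :
    (∀ᵐ ω ∂P, Tendsto
      (fun n => ((Nf : ℝ) * (Nc n : ℝ)) *
        PRake.maiRatioInv Nf (Nc n) (LP n) (fun j l => α n j l ω) k)
      atTop (𝓝 (((K : ℝ) - 1) * PRake.mu Ψ ρ))) ∧
    (∀ᵐ ω ∂P, Tendsto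
      (fun n => ((Nf : ℝ) * (Nc n : ℝ)) *
        (PRake.siRatio Nf (Nc n) (LP n) (fun j l => α n j l ω) k)⁻¹)
      atTop (𝓝 (PRake.nu Ψ ρ β))) := by
  have hpos : ∀ n, 0 < L n := fun n => (hLP n).1.trans_le (hLP n).2
  have hle : ∀ n, LP n ≤ L n := fun n => (hLP n).2
  -- measurable versions of the gains
  let X : (n : ℕ) → Fin K × Fin (L n) → Ω → ℂ := fun n p =>
    (hlaw n p.1 p.2).aemeasurable.mk (α n p.1 p.2)
  have hae : ∀ n p, α n p.1 p.2 =ᵐ[P] X n p := fun n p => (hlaw n p.1 p.2).aemeasurable.ae_eq_mk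
  have hXlaw : ∀ n p, HasLaw (X n p) (PRake.circGaussian (PRake.pathVar (s p.1) Ψ (L n) p.2)) P :=
    fun n p => (hlaw n p.1 p.2).congr (hae n p).symm
  have hG : ∀ n, PRake.Gains P (X n) (fun p => PRake.pathVar (s p.1) Ψ (L n) p.2)
      ((1 + ((∑ k, s k) * (1 + Ψ⁻¹)) ^ 2) * PRake.momentBound) := fun n =>
    PRake.gains_of_hasLaw (fun p => (hlaw n p.1 p.2).aemeasurable.measurable_mk)
      ((hindep n).congr (hae n))
      (fun p => mul_nonneg (hs p.1).le (PRake.profile_pos hΨ (L n) p.2).le)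
      (fun p => mul_le_mul (Finset.single_le_sum (f := s) (fun k _ => (hs k).le)
        (Finset.mem_univ p.1)) (PRake.profile_le hΨ p.2.isLt) (PRake.profile_pos hΨ (L n) p.2).le
        (Finset.sum_nonneg fun k _ => (hs k).le)) (hXlaw n)
  have inj : ∀ n (k : Fin K), Function.Injective fun l : Fin (L n) => (k, l) :=
    fun n k => Prod.mk_right_injective k
  -- There are countably many gains, so one null set serves all replacements.
  have hα : ∀ᵐ ω ∂P, ∀ n j l, α n j l ω = X n (j, l) ω :=
    ae_all_iff.2 fun n => ae_all_iff.2 fun j => ae_all_iff.2 fun l => hae n (j, l)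
  have hpow : ∀ᵐ ω ∂P, ∀ j, Tendsto (fun n => PRake.hSP (PRake.rake (L n) (LP n)
      (fun l => α n j l ω)) (fun l => α n j l ω) / (L n : ℝ)) atTop
      (𝓝 (s j * PRake.powerIntegral (Real.log Ψ) ρ)) := by
    refine ae_all_iff.2 fun j => ?_
    filter_upwards [hα, PRake.ae_tendsto_power hL hpos hΨ (s := s j)
      (X := fun n l => X n (j, l))
      (fun n => (hG n).precomp (inj n j)) hle hLPρ] with ω h1 h2
    simpa only [PRake.hSP_rake, h1] using h2
  have hN : ∀ n, (Nf : ℝ) * (Nc n : ℝ) ≠ 0 := fun n =>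
    mul_ne_zero (by exact_mod_cast hNf.ne') (by exact_mod_cast (hNc n).ne')
  have hLR : ∀ n, (L n : ℝ) ≠ 0 := fun n => by exact_mod_cast (hpos n).ne'
  have hp : PRake.powerIntegral (Real.log Ψ) ρ ≠ 0 := (PRake.powerIntegral_pos hρ).ne'
  constructor
  · have hmai : ∀ᵐ ω ∂P, ∀ j, k ≠ j → Tendsto (fun n => PRake.maiEnergy (LP n)
        (fun l => α n k l ω) (fun l => α n j l ω) / (L n : ℝ) ^ 2) atTop
        (𝓝 (s k * PRake.powerIntegral (Real.log Ψ) ρ *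
          (s j * PRake.powerIntegral (Real.log Ψ) 1))) := by
      refine ae_all_iff.2 fun j => ?_
      by_cases hkj : k = j
      · exact ae_of_all _ fun _ h => absurd hkj h
      · filter_upwards [hα, PRake.ae_tendsto_maiEnergy hL hpos hΨ hG hkj hle hLPρ] with ω h1 h2 _
        simpa only [h1] using h2
    filter_upwards [hpow, hmai] with ω h1 h2
    have hlim : ((K : ℝ) - 1) * PRake.mu Ψ ρ
        = ∑ j ∈ Finset.univ.erase k, s k * PRake.powerIntegral (Real.log Ψ) ρ *
          (s j * PRake.powerIntegral (Real.log Ψ) 1) /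
          ((s k * PRake.powerIntegral (Real.log Ψ) ρ) *
            (s j * PRake.powerIntegral (Real.log Ψ) ρ)) := by
      have : ∀ j ∈ Finset.univ.erase k, s k * PRake.powerIntegral (Real.log Ψ) ρ *
          (s j * PRake.powerIntegral (Real.log Ψ) 1) /
          ((s k * PRake.powerIntegral (Real.log Ψ) ρ) *
            (s j * PRake.powerIntegral (Real.log Ψ) ρ)) = PRake.mu Ψ ρ := fun j _ => by
        have hk := (hs k).ne'
        have hj := (hs j).ne'
        rw [PRake.mu_eq hΨ hρ]
        field_simp
      -- All `K - 1` summands equal `μ`, since the scales `s k` and `s j` cancel; `K ≥ 1` because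
      -- the user `k` exists.
      rw [Finset.sum_congr rfl this, Finset.sum_const, Finset.card_erase_of_mem (Finset.mem_univ k),
        Finset.card_univ, Fintype.card_fin, nsmul_eq_mul, Nat.cast_pred (Fin.pos k)]
    rw [hlim]
    have hsum := tendsto_finsetSum (Finset.univ.erase k) fun j hj =>
      (h2 j (Finset.ne_of_mem_erase hj).symm).div ((h1 k).mul (h1 j))
        (mul_ne_zero (mul_ne_zero (hs k).ne' hp) (mul_ne_zero (hs j).ne' hp))
    refine hsum.congr fun n => ?_
    rw [PRake.maiRatioInv, Finset.mul_sum]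
    refine Finset.sum_congr rfl fun j _ => ?_
    rw [PRake.hMAI, ← PRake.maiEnergy]
    simp only [Pi.div_apply]
    -- The factors `L²` of the energy and of the product of powers cancel, and `N` cancels the `1 /
    -- N` in `hMAI`.
    rw [div_mul_div_comm, ← pow_two, div_div_div_cancel_right₀ (pow_ne_zero 2 (hLR n)),
      ← mul_div_assoc, ← mul_assoc, mul_one_div_cancel (hN n), one_mul, div_div]
  · have hsi := PRake.ae_tendsto_siEnergy hL hpos hΨ (s := s k)
      (X := fun n l => X n (k, l)) (fun n => (hG n).precomp (inj n k)) hle hβ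
      hLPρ hNcβ
    filter_upwards [hα, hpow, hsi] with ω h0 h1 h2
    have hlim : PRake.nu Ψ ρ β = s k ^ 2 * (PRake.siIntegral ρ β (Real.log Ψ) / β) /
        (s k * PRake.powerIntegral (Real.log Ψ) ρ) ^ 2 := by
      have hk := (hs k).ne'
      rw [PRake.nu_eq hΨ hρ hρ1 hβ]
      field_simp
    rw [hlim]
    refine (h2.div ((h1 k).pow 2) (pow_ne_zero 2 (mul_ne_zero (hs k).ne' hp))).congr fun n => ?_
    simp only [Pi.div_apply, ← h0]
    rw [PRake.siRatio, PRake.hSI, ← PRake.siEnergy, inv_div, ← mul_div_assoc, ← mul_assoc,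
      mul_one_div_cancel (hN n), one_mul, div_pow,
      div_div_div_cancel_right₀ (pow_ne_zero 2 (hLR n)), pow_two, div_div]
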